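/- Let $d\ge 1$. Write $|x|=\sum_{i}|x_i|$ for $x\in\mathbb R^d$ and let $\|\cdot\|$ be the corresponding operator norm on $d\times d$ matrices. Let $N$ be an $\mathbb N$-valued random variable and $A_1,A_2,\dots$ random $d\times d$ matrices with nonnegative entries, defined on the same probability space, such that $N\ge 1$ a.s., $1<\mathbb E[N]<\infty$, and a.s. $A_i\neq 0$ for $1\le i\le N$ and $A_i=0$ for $i>N$. Assume the Furstenberg–Kesten condition: there is a constant $c>1$ such that a.s. $$0<\max_{1\le i,j\le d}A_1(i,j)\le c\min_{1\le i,j\le d}A_1(i,j).$$ Let $Z$ be an $\mathbb R_+^d$-valued random variable with $\mathbb P[Z=0]=0$ which satisfies $$Z\overset{\mathcal L}{=}\sum_{i=1}^N A_iZ_i,$$ where $(Z_i)_{i\ge1}$ are i.i.d. copies of $Z$, independent of $(N,A_1,A_2,\dots)$. Let $a>0$ be such that $\mathbb E[\|A_1\|^{-a}]<\infty$. 1. If $\mathbb P[N=1]=0$, then $\mathbb E[|Z|^{-b}]<\infty$ for all $b\in(0,a)$. 2. Suppose $\mathbb P[N=1]>0$, and let $(\tilde A_i)_{i\ge1}$ be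 i.i.d. random matrices whose common law is that of $A_1$ conditioned on $\{N=1\}$. Then the limit $$\tilde\kappa(-a)=\lim_{n\to\infty}\mathbb E\big[\|\tilde A_n\cdots\tilde A_1\|^{-a}\big]^{1/n}$$ exists in $(0,\infty)$. Consider the statements (a) $\mathbb E[|Z|^{-a}]<\infty$; (b) $\tilde\kappa(-a)\,\mathbb P[N=1]<1$; (c) $\mathbb E[|Z|^{-b}]<\infty$ for all $b\in(0,a)$. Then (a) $\Rightarrow$ (b) $\Rightarrow$ (c). If in addition $\mathbb E[\|A_1\|^{-a-\varepsilon}]<\infty$ for some $\varepsilon>0$, then (a) $\Leftrightarrow$ (b). -/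

import Mathlib

open MeasureTheory ProbabilityTheory Filter Topology
open scoped ENNReal Matrix

namespace Smoothing

/-- The `L¹` norm `|x| = ∑ i, |x i|` of a vector. -/
noncomputable def vecNorm {d : ℕ} (x : Fin d → ℝ) : ℝ := ∑ i, |x i|

/-- The operator norm of a matrix for the `L¹` norm on vectors, i.e. its maximal column sum
(see `opNorm_isLeast`). -/
noncomputable def opNorm {d : ℕ} (a : Matrix (Fin d) (Fin d) ℝ) : ℝ := ⨆ j, ∑ i, |a i j|

theorem opNorm_isLeast {d : ℕ} (a : Matrix (Fin d) (Fin d) ℝ) :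
    IsLeast {C : ℝ | 0 ≤ C ∧ ∀ x, vecNorm (a *ᵥ x) ≤ C * vecNorm x} (opNorm a) := by
  have hb : BddAbove (Set.range fun j => ∑ i, |a i j|) := Set.finite_range _ |>.bddAbove
  refine ⟨⟨Real.iSup_nonneg fun j => Finset.sum_nonneg fun i _ => abs_nonneg _, fun x => ?_⟩, ?_⟩
  · calc vecNorm (a *ᵥ x) ≤ ∑ i, ∑ j, |a i j| * |x j| := by
          refine Finset.sum_le_sum fun i _ => ?_
          simp only [Matrix.mulVec, dotProduct, ← abs_mul]
          exact Finset.abs_sum_le_sum_abs _ _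
      _ = ∑ j, (∑ i, |a i j|) * |x j| := by
          rw [Finset.sum_comm]
          simp only [Finset.sum_mul]
      _ ≤ ∑ j, opNorm a * |x j| :=
          Finset.sum_le_sum fun j _ => mul_le_mul_of_nonneg_right (le_ciSup hb j) (abs_nonneg _)
      _ = opNorm a * vecNorm x := by rw [vecNorm, Finset.mul_sum]
  · rintro C ⟨h0, hC⟩
    refine Real.iSup_le (fun j => ?_) h0
    have h := hC (Pi.single j 1)
    have h1 : vecNorm (Pi.single j (1 : ℝ)) = 1 := by
      simp [vecNorm, Pi.single_apply, apply_ite abs]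
    rw [h1, mul_one] at h
    simpa [vecNorm] using h

variable {Ω : Type*} [MeasurableSpace Ω] {d : ℕ}

/-- The standing condition on `(N, A₁, A₂, …)`. The sequence is indexed from `0`, so that
`A i` stands for `A_{i+1}`. -/
structure PointProcessCondition (P : Measure Ω) (N : Ω → ℕ)
    (A : ℕ → Ω → Matrix (Fin d) (Fin d) ℝ) : Prop where
  one_le : ∀ᵐ ω ∂P, 1 ≤ N ω
  one_lt_mean : 1 < ∫⁻ ω, (N ω : ℝ≥0∞) ∂P
  mean_lt_top : ∫⁻ ω, (N ω : ℝ≥0∞) ∂P < ∞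
  nonneg : ∀ᵐ ω ∂P, ∀ i j k, 0 ≤ A i ω j k
  ne_zero : ∀ᵐ ω ∂P, ∀ i, i < N ω → A i ω ≠ 0
  eq_zero : ∀ᵐ ω ∂P, ∀ i, N ω ≤ i → A i ω = 0

/-- The Furstenberg–Kesten condition on a random matrix `M`: for some constant `c > 1`, almost
surely `0 < max M(i,j) ≤ c * min M(i,j)`. -/
def FurstenbergKesten (P : Measure Ω) (M : Ω → Matrix (Fin d) (Fin d) ℝ) : Prop :=
  ∃ c : ℝ, 1 < c ∧ ∀ᵐ ω ∂P,
    (∃ i j, 0 < M ω i j) ∧ ∀ i j k l, M ω i j ≤ c * M ω k l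

/-- The smoothing transform: the law of `∑_{i=1}^N A_i Z_i`, where `(Z_i)` are i.i.d. with law
the probability measure `η` and independent of `(N, A₁, A₂, …)`. -/
noncomputable def smoothingTransform (P : Measure Ω) (N : Ω → ℕ)
    (A : ℕ → Ω → Matrix (Fin d) (Fin d) ℝ) (η : Measure (Fin d → ℝ)) :
    Measure (Fin d → ℝ) :=
  (P.prod (Measure.infinitePi fun _ : ℕ => η)).map
    fun p => ∑ i ∈ Finset.range (N p.1), A i p.1 *ᵥ p.2 i

/-- The moment `E[‖M‖ ^ s]` of a random matrix, with values in `[0, ∞]`. -/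
noncomputable def matMoment (P : Measure Ω) (M : Ω → Matrix (Fin d) (Fin d) ℝ) (s : ℝ) : ℝ≥0∞ :=
  ∫⁻ ω, ENNReal.ofReal (opNorm (M ω)) ^ s ∂P

/-- The moment `E[|X| ^ s]` of a random vector, with values in `[0, ∞]`. -/
noncomputable def vecMoment (P : Measure Ω) (X : Ω → Fin d → ℝ) (s : ℝ) : ℝ≥0∞ :=
  ∫⁻ ω, ENNReal.ofReal (vecNorm (X ω)) ^ s ∂P

/-- `E[‖Ã_n ⋯ Ã_1‖ ^ s] ^ (1/n)`, where `Ã_1, …, Ã_n` are i.i.d. with the law of `A₁` conditioned on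
`N = 1`. They are realised as `A₁` evaluated at independent points `ω₁, …, ω_n`, each with law
`P[· | N = 1]`. -/
noncomputable def kappaSeq (P : Measure Ω) (N : Ω → ℕ)
    (A : ℕ → Ω → Matrix (Fin d) (Fin d) ℝ) (s : ℝ) (n : ℕ) : ℝ≥0∞ :=
  matMoment (Measure.pi fun _ : Fin n => ProbabilityTheory.cond P {ω | N ω = 1})
    (fun w => (List.ofFn fun k : Fin n => A 0 (w k.rev)).prod) s ^ ((n : ℝ)⁻¹)

/-- `κ̃(s) = lim_n E[‖Ã_n ⋯ Ã_1‖ ^ s] ^ (1/n)`. -/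
noncomputable def kappa (P : Measure Ω) (N : Ω → ℕ)
    (A : ℕ → Ω → Matrix (Fin d) (Fin d) ℝ) (s : ℝ) : ℝ≥0∞ :=
  limUnder atTop (kappaSeq P N A s)

end Smoothing

/-!
Let `T f(x) = E[f(A₁ x); N = 1]`. By the Furstenberg–Kesten condition, `‖M x‖` is comparable to
`‖M‖ ‖x‖` for the products `M` of the conditioned matrices and `x ≥ 0`. Hence the moments
`E[‖Ã_n ⋯ Ã_1‖ ^ (-a)]` are multiplicative in `n` up to a constant, the limit `κ` of their roots
exists, and `T^k |·|^(-a)` is comparable to `θ^k |·|^(-a)` with `θ = κ P[N = 1]`.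

For the law `η` of `Z`, the fixed point equation says that `∫ f dη` is `∫ T f dη` plus a
contribution of `N ≥ 2`. If `θ ≥ 1`, apply it to `f = T^k |·|^(-a)`: these integrals decrease by at
least a fixed positive amount with every `k`, so the first one is infinite. If `θ < 1`, then
`V = ∑ ρ^(-k) T^k |·|^(-a)` with `θ < ρ < 1` satisfies `T V ≤ ρ V`. When `N ≥ 2`, the sum
`∑ A_i Z_i` dominates both `A₁ Z₁` and `A₂ Z₂`, and `|A₂ Z₂|` is small only with small probability,
independently of `Z₁`. Applied to the truncations `V ∧ n`, the equation therefore gives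
`∫ V ∧ n dη ≤ t ∫ V ∧ n dη + D` with `t < 1` and `D` independent of `n`.
-/

namespace Smoothing

section GeometricBounds

theorem le_inv_one_sub_mul_of_le_mul_add {x t D : ℝ≥0∞} (hx : x ≠ ∞) (ht : t < 1)
    (h : x ≤ t * x + D) : x ≤ (1 - t)⁻¹ * D := by
  have h0 : 1 - t ≠ 0 := (tsub_pos_of_lt ht).ne'
  have h1 : 1 - t ≠ ∞ := ENNReal.sub_ne_top ENNReal.one_ne_top
  rw [mul_comm, ← div_eq_mul_inv, ENNReal.le_div_iff_mul_le (.inl h0) (.inl h1), mul_comm,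
    ENNReal.sub_mul fun _ _ => hx, one_mul]
  exact tsub_le_iff_left.2 h

variable {u : ℕ → ℝ≥0∞} {K : ℝ≥0∞}

theorem pow_le_pow_mul_apply_mul (h0 : u 0 = 1) (h : ∀ m n, u m * u n ≤ K * u (m + n))
    (m n : ℕ) : u m ^ n ≤ K ^ n * u (m * n) := by
  induction n with
  | zero => simp [h0]
  | succ n ih =>
    calc u m ^ (n + 1) ≤ K ^ n * u (m * n) * u m := by rw [pow_succ]; gcongr
      _ = K ^ n * (u (m * n) * u m) := mul_assoc _ _ _
      _ ≤ K ^ n * (K * u (m * n + m)) := mul_le_mul_right (h _ _) _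
      _ = K ^ (n + 1) * u (m * (n + 1)) := by rw [← mul_assoc, pow_succ, mul_add_one]

theorem apply_mul_le_pow_mul_pow (h0 : u 0 = 1) (h : ∀ m n, u (m + n) ≤ K * (u m * u n))
    (m n : ℕ) : u (m * n) ≤ K ^ n * u m ^ n := by
  induction n with
  | zero => simp [h0]
  | succ n ih =>
    calc u (m * (n + 1)) ≤ K * (u (m * n) * u m) := h _ _
      _ ≤ K * (K ^ n * u m ^ n * u m) := by gcongr
      _ = K ^ (n + 1) * u m ^ (n + 1) := by ring

theorem exists_le_mul_pow_and_pow_le_mul (hK : K ≠ ∞) (h0 : u 0 = 1)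
    (hle : ∀ m n, u (m + n) ≤ K * (u m * u n)) (hge : ∀ m n, u m * u n ≤ K * u (m + n)) :
    ∃ κ : ℝ≥0∞, ∀ n, u n ≤ K * κ ^ n ∧ κ ^ n ≤ K * u n := by
  have hK1 : 1 ≤ K := by simpa [h0] using hle 0 0
  have hK0 : K ≠ 0 := (one_pos.trans_le hK1).ne'
  have hcross : ∀ m n : ℕ, (K⁻¹ * u m) ^ n ≤ (K * u n) ^ m := fun m n => by
    calc (K⁻¹ * u m) ^ n = (K ^ n)⁻¹ * u m ^ n := by rw [mul_pow, ENNReal.inv_pow]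
      _ ≤ u (m * n) := by
        rw [ENNReal.inv_mul_le_iff (pow_ne_zero _ hK0) (ENNReal.pow_ne_top hK)]
        exact pow_le_pow_mul_apply_mul h0 hge m n
      _ ≤ (K * u n) ^ m := by
        rw [mul_comm m n, mul_pow]
        exact apply_mul_le_pow_mul_pow h0 hle n m
  set κ : ℝ≥0∞ := ⨆ m : ℕ, (K⁻¹ * u (m + 1)) ^ (((m + 1 : ℕ) : ℝ)⁻¹)
  refine ⟨κ, fun n => ?_⟩
  rcases n with _ | n
  · simpa [h0] using hK1
  constructor
  · rw [← ENNReal.inv_mul_le_iff hK0 hK]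
    calc K⁻¹ * u (n + 1) = ((K⁻¹ * u (n + 1)) ^ (((n + 1 : ℕ) : ℝ)⁻¹)) ^ (n + 1) :=
          (ENNReal.rpow_inv_natCast_pow n.succ_ne_zero _).symm
      _ ≤ κ ^ (n + 1) := by
          gcongr
          exact le_iSup (fun m : ℕ => (K⁻¹ * u (m + 1)) ^ (((m + 1 : ℕ) : ℝ)⁻¹)) n
  · have hn : (0 : ℝ) < ((n + 1 : ℕ) : ℝ) := by positivity
    rw [← ENNReal.rpow_natCast, ← ENNReal.le_rpow_inv_iff hn]
    refine iSup_le fun m => ?_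
    have hm : (0 : ℝ) < ((m + 1 : ℕ) : ℝ) := by positivity
    rw [ENNReal.rpow_inv_le_iff hm, ← ENNReal.rpow_mul, mul_comm (_ : ℝ)⁻¹, ENNReal.rpow_mul,
      ENNReal.le_rpow_inv_iff hn, ENNReal.rpow_natCast, ENNReal.rpow_natCast]
    exact hcross _ _

theorem tendsto_rpow_inv_natCast (hK0 : K ≠ 0) (hK : K ≠ ∞) :
    Tendsto (fun n : ℕ => K ^ ((n : ℝ)⁻¹)) atTop (𝓝 1) := by
  lift K to NNReal using hK
  have hK' : K ≠ 0 := by exact_mod_cast hK0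
  simp only [← ENNReal.coe_rpow_of_ne_zero hK']
  have h : Tendsto (fun n : ℕ => K ^ ((n : ℝ)⁻¹)) atTop (𝓝 (K ^ (0 : ℝ))) :=
    tendsto_const_nhds.nnrpow tendsto_inv_atTop_nhds_zero_nat (.inl hK')
  simpa using ENNReal.tendsto_coe.2 h

theorem tendsto_rpow_inv_of_le_mul_pow {κ : ℝ≥0∞} (hK0 : K ≠ 0) (hK : K ≠ ∞)
    (hle : ∀ n, u n ≤ K * κ ^ n) (hge : ∀ n, κ ^ n ≤ K * u n) :
    Tendsto (fun n : ℕ => u n ^ ((n : ℝ)⁻¹)) atTop (𝓝 κ) := by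
  have hlim : ∀ {C : ℝ≥0∞}, C ≠ 0 → C ≠ ∞ →
      Tendsto (fun n : ℕ => C ^ ((n : ℝ)⁻¹) * κ) atTop (𝓝 κ) := fun h0 h => by
    simpa using ENNReal.Tendsto.mul_const (tendsto_rpow_inv_natCast h0 h) (.inl one_ne_zero)
  have hroot : ∀ (C : ℝ≥0∞) {n : ℕ}, n ≠ 0 →
      (C * κ ^ n) ^ ((n : ℝ)⁻¹) = C ^ ((n : ℝ)⁻¹) * κ := fun C n hn => by
    rw [ENNReal.mul_rpow_of_nonneg _ _ (by positivity), ENNReal.pow_rpow_inv_natCast hn]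
  refine tendsto_of_tendsto_of_tendsto_of_le_of_le'
    (hlim (ENNReal.inv_ne_zero.2 hK) (ENNReal.inv_ne_top.2 hK0)) (hlim hK0 hK) ?_ ?_
  all_goals filter_upwards [eventually_ne_atTop 0] with n hn
  · rw [← hroot _ hn]
    gcongr
    exact (ENNReal.inv_mul_le_iff hK0 hK).2 (hge n)
  · rw [← hroot _ hn]
    gcongr
    exact hle n

end GeometricBounds

section Matrices

variable {d : ℕ} {B M : Matrix (Fin d) (Fin d) ℝ} {c : ℝ} {x y : Fin d → ℝ}

theorem vecNorm_nonneg (x : Fin d → ℝ) : 0 ≤ vecNorm x :=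
  Finset.sum_nonneg fun _ _ => abs_nonneg _

theorem vecNorm_eq_sum (hx : 0 ≤ x) : vecNorm x = ∑ i, x i :=
  Finset.sum_congr rfl fun i _ => abs_of_nonneg (hx i)

theorem vecNorm_eq_zero_iff : vecNorm x = 0 ↔ x = 0 := by
  rw [vecNorm, Finset.sum_eq_zero_iff_of_nonneg fun _ _ => abs_nonneg _]
  simp [funext_iff]

theorem vecNorm_mono (hx : 0 ≤ x) (hxy : x ≤ y) : vecNorm x ≤ vecNorm y := by
  rw [vecNorm_eq_sum hx, vecNorm_eq_sum (hx.trans hxy)]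
  exact Finset.sum_le_sum fun i _ => hxy i

theorem measurable_vecNorm : Measurable (vecNorm : (Fin d → ℝ) → ℝ) := by
  unfold vecNorm
  fun_prop

theorem opNorm_nonneg (B : Matrix (Fin d) (Fin d) ℝ) : 0 ≤ opNorm B := (opNorm_isLeast B).1.1

theorem vecNorm_mulVec_le (B : Matrix (Fin d) (Fin d) ℝ) (x : Fin d → ℝ) :
    vecNorm (B *ᵥ x) ≤ opNorm B * vecNorm x := (opNorm_isLeast B).1.2 x

theorem opNorm_one [NeZero d] : opNorm (1 : Matrix (Fin d) (Fin d) ℝ) = 1 := by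
  simp [opNorm, Matrix.one_apply, apply_ite abs]

theorem mulVec_nonneg (hB : ∀ i j, 0 ≤ B i j) (hx : 0 ≤ x) : 0 ≤ B *ᵥ x :=
  fun i => dotProduct_nonneg_of_nonneg (hB i) hx

theorem mulVec_mono (hB : ∀ i j, 0 ≤ B i j) (hxy : x ≤ y) : B *ᵥ x ≤ B *ᵥ y :=
  fun i => dotProduct_le_dotProduct_of_nonneg_left hxy (hB i)

theorem mulVec_pos (hB : ∀ i j, 0 < B i j) (hx : 0 ≤ x) (hx0 : x ≠ 0) (i : Fin d) :
    0 < (B *ᵥ x) i := by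
  obtain ⟨j, hj⟩ := Function.ne_iff.1 hx0
  exact Finset.sum_pos' (fun k _ => mul_nonneg (hB i k).le (hx k))
    ⟨j, Finset.mem_univ _, mul_pos (hB i j) ((hx j).lt_of_ne (Ne.symm hj))⟩

theorem vecNorm_mulVec_pos (hB : ∀ i j, 0 ≤ B i j) (hB0 : B ≠ 0) (hx : ∀ i, 0 < x i) :
    0 < vecNorm (B *ᵥ x) := by
  refine (vecNorm_nonneg _).lt_of_ne fun h => hB0 ?_
  ext i j
  have hi : ∑ k, B i k * x k = 0 := congrFun (vecNorm_eq_zero_iff.1 h.symm) i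
  rw [Finset.sum_eq_zero_iff_of_nonneg fun k _ => mul_nonneg (hB i k) (hx k).le] at hi
  exact (mul_eq_zero.1 (hi j (Finset.mem_univ j))).resolve_right (hx j).ne'

/-- Within each row, the entries of `M` are comparable up to the factor `c`. This is the part of
the Furstenberg–Kesten condition that is preserved by multiplication from the left by a
nonnegative matrix. -/
def RowComparable (c : ℝ) (M : Matrix (Fin d) (Fin d) ℝ) : Prop :=
  ∀ i j k, M i j ≤ c * M i k

theorem RowComparable.mul_left (hB : ∀ i j, 0 ≤ B i j) (hM : RowComparable c M) :
    RowComparable c (B * M) := fun i j k => by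
  rw [Matrix.mul_apply, Matrix.mul_apply, Finset.mul_sum]
  refine Finset.sum_le_sum fun l _ => ?_
  rw [mul_left_comm]
  exact mul_le_mul_of_nonneg_left (hM l j k) (hB i l)

theorem RowComparable.one_le [NeZero d] (hM : RowComparable c M) (hpos : ∀ i j, 0 < M i j) :
    1 ≤ c :=
  le_of_mul_le_mul_right (by simpa using hM 0 0 0) (hpos 0 0)

/-- The column sums of `M` agree up to the factor `c`, and `‖M‖` is the largest of them. -/
theorem RowComparable.opNorm_mul_vecNorm_le (hc : 0 ≤ c) (hM : RowComparable c M)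
    (hM0 : ∀ i j, 0 ≤ M i j) (hx : 0 ≤ x) : opNorm M * vecNorm x ≤ c * vecNorm (M *ᵥ x) := by
  have hcol : ∀ k, opNorm M ≤ c * ∑ i, M i k := fun k =>
    Real.iSup_le
      (fun j => by
        simpa only [abs_of_nonneg (hM0 _ _), Finset.mul_sum] using
          Finset.sum_le_sum fun i _ => hM i j k)
      (mul_nonneg hc (Finset.sum_nonneg fun i _ => hM0 i k))
  calc opNorm M * vecNorm x = ∑ k, opNorm M * x k := by rw [vecNorm_eq_sum hx, Finset.mul_sum]
    _ ≤ ∑ k, (c * ∑ i, M i k) * x k :=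
      Finset.sum_le_sum fun k _ => mul_le_mul_of_nonneg_right (hcol k) (hx k)
    _ = c * ∑ i, ∑ k, M i k * x k := by
      rw [Finset.sum_comm, Finset.mul_sum]
      simp only [mul_assoc, Finset.sum_mul]
    _ = c * vecNorm (M *ᵥ x) := by rw [vecNorm_eq_sum (mulVec_nonneg hM0 hx)]; rfl

end Matrices

section NegPow

variable {d : ℕ} {a c : ℝ}

/-- The function `x ↦ |x| ^ (-a)` with values in `[0, ∞]`; for `a > 0` it is `∞` at `0`. -/
noncomputable def negPow (a : ℝ) (x : Fin d → ℝ) : ℝ≥0∞ := ENNReal.ofReal (vecNorm x) ^ (-a)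

theorem measurable_negPow (a : ℝ) : Measurable (negPow a : (Fin d → ℝ) → ℝ≥0∞) :=
  (ENNReal.measurable_ofReal.comp measurable_vecNorm).pow_const _

theorem ofReal_rpow_neg_ne_zero (ha : 0 < a) (r : ℝ) : ENNReal.ofReal r ^ (-a) ≠ 0 := by
  simp [ENNReal.rpow_eq_zero_iff, ha, ha.le]

theorem rpow_neg_antitone (ha : 0 ≤ a) : Antitone fun s : ℝ≥0∞ => s ^ (-a) := fun s t h => by
  simp only [ENNReal.rpow_neg]
  gcongr

theorem negPow_le_ofReal_rpow (ha : 0 ≤ a) {s : ℝ} {x : Fin d → ℝ} (h : s ≤ vecNorm x) :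
    negPow a x ≤ ENNReal.ofReal s ^ (-a) :=
  rpow_neg_antitone ha (ENNReal.ofReal_le_ofReal h)

theorem antitoneOn_negPow (ha : 0 ≤ a) :
    AntitoneOn (negPow a : (Fin d → ℝ) → ℝ≥0∞) (Set.Ici 0) := fun _ hx _ _ hxy =>
  negPow_le_ofReal_rpow ha (vecNorm_mono hx hxy)

theorem ofReal_mul_rpow_neg {r s : ℝ} (hr : 0 ≤ r) :
    ENNReal.ofReal (r * s) ^ (-a) = ENNReal.ofReal r ^ (-a) * ENNReal.ofReal s ^ (-a) := by
  rw [ENNReal.ofReal_mul hr,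
    ENNReal.mul_rpow_of_ne_top ENNReal.ofReal_ne_top ENNReal.ofReal_ne_top]

theorem le_negPow_mulVec (ha : 0 ≤ a) (B : Matrix (Fin d) (Fin d) ℝ) (x : Fin d → ℝ) :
    ENNReal.ofReal (opNorm B) ^ (-a) * negPow a x ≤ negPow a (B *ᵥ x) := by
  rw [negPow, ← ofReal_mul_rpow_neg (opNorm_nonneg B)]
  exact rpow_neg_antitone ha (ENNReal.ofReal_le_ofReal (vecNorm_mulVec_le B x))

theorem negPow_mulVec_le (ha : 0 ≤ a) (hc : 0 < c) {B : Matrix (Fin d) (Fin d) ℝ}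
    {x : Fin d → ℝ} (h : opNorm B * vecNorm x ≤ c * vecNorm (B *ᵥ x)) :
    negPow a (B *ᵥ x) ≤
      ENNReal.ofReal c ^ a * (ENNReal.ofReal (opNorm B) ^ (-a) * negPow a x) := by
  have hc0 : ENNReal.ofReal c ^ a ≠ 0 := by simp [ENNReal.rpow_eq_zero_iff, hc, ha.not_gt]
  have hca : ENNReal.ofReal c ^ a ≠ ∞ :=
    ENNReal.rpow_ne_top_of_nonneg ha ENNReal.ofReal_ne_top
  rw [← ENNReal.inv_mul_le_iff hc0 hca, ← ENNReal.rpow_neg, negPow, negPow,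
    ← ofReal_mul_rpow_neg hc.le, ← ofReal_mul_rpow_neg (opNorm_nonneg B)]
  exact rpow_neg_antitone ha (ENNReal.ofReal_le_ofReal h)

end NegPow

section MeasureTools

variable {X Y ι : Type*} [MeasurableSpace X] [MeasurableSpace Y]

theorem exists_pos_measure_lt_lt {μ : Measure X} [IsFiniteMeasure μ] {φ : X → ℝ}
    (hφ : Measurable φ) (hpos : ∀ᵐ x ∂μ, 0 < φ x) {δ : ℝ≥0∞} (hδ : 0 < δ) :
    ∃ s : ℝ, 0 < s ∧ μ {x | φ x < s} < δ := by
  have hlim : Tendsto (fun s => μ {x | φ x < s}) (𝓝[>] (0 : ℝ))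
      (𝓝 (μ (⋂ s > (0 : ℝ), {x | φ x < s}))) :=
    tendsto_measure_biInter_gt
      (fun s _ => (measurableSet_lt hφ measurable_const).nullMeasurableSet)
      (fun s t _ hst x (hx : φ x < s) => hx.trans_le hst) ⟨1, one_pos, measure_ne_top _ _⟩
  have hzero : μ (⋂ s > (0 : ℝ), {x | φ x < s}) = 0 := by
    rw [measure_eq_zero_iff_ae_notMem]
    filter_upwards [hpos] with x hx hmem
    exact lt_irrefl (φ x) (Set.mem_iInter₂.1 hmem _ hx)
  rw [hzero] at hlim
  obtain ⟨s, hs, hs0⟩ :=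
    ((hlim.eventually_lt_const hδ).and self_mem_nhdsWithin).exists
  exact ⟨s, hs0, hs⟩

theorem exists_pos_lintegral_mul_measure_lt_lt {μ : Measure X} {η : Measure Y}
    [IsFiniteMeasure η] {L : X → ℝ≥0∞} (hL : Measurable L) (hLint : ∫⁻ x, L x ∂μ ≠ ∞)
    {φ : X × Y → ℝ} (hφ : Measurable φ) (hpos : ∀ᵐ x ∂μ, ∀ᵐ y ∂η, 0 < φ (x, y))
    {δ : ℝ≥0∞} (hδ : 0 < δ) :
    ∃ s : ℝ, 0 < s ∧ ∫⁻ x, L x * η {y | φ (x, y) < s} ∂μ < δ := by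
  have := isFiniteMeasure_withDensity hLint
  have hset : ∀ s, MeasurableSet {p | φ p < s} := fun s => measurableSet_lt hφ measurable_const
  have hae : ∀ᵐ p ∂((μ.withDensity L).prod η), 0 < φ p :=
    (Measure.ae_prod_mem_iff_ae_ae_mem (measurableSet_lt measurable_const hφ)).2
      ((withDensity_absolutelyContinuous μ L).ae_le hpos)
  obtain ⟨s, hs, hlt⟩ := exists_pos_measure_lt_lt hφ hae hδ
  refine ⟨s, hs, ?_⟩
  rwa [Measure.prod_apply (hset s), lintegral_withDensity_eq_lintegral_mul _ hL
    (measurable_measure_prodMk_left (hset s))] at hlt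

theorem lintegral_ne_zero {μ : Measure X} [NeZero μ] {f : X → ℝ≥0∞} (hf : Measurable f)
    (hf0 : ∀ x, f x ≠ 0) : ∫⁻ x, f x ∂μ ≠ 0 := fun h => by
  obtain ⟨x, hx⟩ := ((lintegral_eq_zero_iff hf).1 h).exists
  exact hf0 x hx

variable {η : Measure X} [IsProbabilityMeasure η]

theorem ae_infinitePi_forall [Countable ι] {p : X → Prop} (h : ∀ᵐ x ∂η, p x) :
    ∀ᵐ z ∂(Measure.infinitePi fun _ : ι => η), ∀ i, p (z i) :=
  ae_all_iff.2 fun i =>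
    (measurePreserving_eval_infinitePi (fun _ : ι => η) i).quasiMeasurePreserving.ae h

theorem lintegral_infinitePi_eval {f : X → ℝ≥0∞} (hf : Measurable f) (i : ι) :
    ∫⁻ z, f (z i) ∂(Measure.infinitePi fun _ : ι => η) = ∫⁻ x, f x ∂η :=
  (measurePreserving_eval_infinitePi (fun _ : ι => η) i).lintegral_comp hf

theorem lintegral_infinitePi_mul {f g : X → ℝ≥0∞} (hf : Measurable f) (hg : Measurable g)
    {i j : ι} (hij : i ≠ j) :
    ∫⁻ z, f (z i) * g (z j) ∂(Measure.infinitePi fun _ : ι => η) =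
      (∫⁻ x, f x ∂η) * ∫⁻ x, g x ∂η := by
  have hind : IndepFun (fun z : ι → X => z i) (fun z => z j)
      (Measure.infinitePi fun _ : ι => η) :=
    (iIndepFun_infinitePi (P := fun _ : ι => η) (X := fun _ x => x)
      fun _ => measurable_id).indepFun hij
  rw [← lintegral_infinitePi_eval hf i, ← lintegral_infinitePi_eval hg j]
  exact lintegral_mul_eq_lintegral_mul_lintegral_of_indepFun''
    (hf.comp (measurable_pi_apply i)).aemeasurable (hg.comp (measurable_pi_apply j)).aemeasurable
    (hind.comp hf hg)

end MeasureTools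

section Transfer

variable {Ω : Type*} [MeasurableSpace Ω] {d : ℕ} {ν : Measure Ω}
  {M : Ω → Matrix (Fin d) (Fin d) ℝ} {f g : (Fin d → ℝ) → ℝ≥0∞}

theorem measurable_mulVec (hM : ∀ i j, Measurable fun ω => M ω i j) {v : Ω → Fin d → ℝ}
    (hv : Measurable v) : Measurable fun ω => M ω *ᵥ v ω := by
  refine measurable_pi_iff.2 fun i => ?_
  simp only [Matrix.mulVec, dotProduct]
  exact Finset.measurable_fun_sum _ fun j _ => (hM i j).mul ((measurable_pi_apply j).comp hv)

theorem measurable_opNorm (hM : ∀ i j, Measurable fun ω => M ω i j) :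
    Measurable fun ω => opNorm (M ω) := by
  unfold opNorm
  exact Measurable.iSup fun j => Finset.measurable_fun_sum _ fun i _ =>
    continuous_abs.measurable.comp (hM i j)

theorem measurable_opNorm_rpow (hM : ∀ i j, Measurable fun ω => M ω i j) (s : ℝ) :
    Measurable fun ω => ENNReal.ofReal (opNorm (M ω)) ^ s :=
  (measurable_opNorm hM).ennreal_ofReal.pow_const s

theorem measurable_uncurry_mulVec (hM : ∀ i j, Measurable fun ω => M ω i j) :
    Measurable fun p : Ω × (Fin d → ℝ) => M p.1 *ᵥ p.2 :=
  measurable_mulVec (fun i j => (hM i j).comp measurable_fst) measurable_snd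

/-- The transfer operator of the random matrix `M` under the measure `ν`, that is
`f ↦ (x ↦ E[f(M x)])`. The measure `ν` need not be normalised: restricting a probability measure
to an event gives `f ↦ (x ↦ E[f(M x); event])`. -/
noncomputable def transfer (ν : Measure Ω) (M : Ω → Matrix (Fin d) (Fin d) ℝ)
    (f : (Fin d → ℝ) → ℝ≥0∞) (x : Fin d → ℝ) : ℝ≥0∞ := ∫⁻ ω, f (M ω *ᵥ x) ∂ν

theorem measurable_transfer [SFinite ν] (hM : ∀ i j, Measurable fun ω => M ω i j)
    (hf : Measurable f) : Measurable (transfer ν M f) :=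
  (hf.comp (measurable_uncurry_mulVec hM)).lintegral_prod_left'

theorem measurable_transfer_iterate [SFinite ν] (hM : ∀ i j, Measurable fun ω => M ω i j)
    (hf : Measurable f) (k : ℕ) : Measurable ((transfer ν M)^[k] f) :=
  Function.Iterate.rec _ hf (fun _ => measurable_transfer hM) k

theorem transfer_mono (ν : Measure Ω) (M : Ω → Matrix (Fin d) (Fin d) ℝ) :
    Monotone (transfer ν M) := fun _ _ h _ => lintegral_mono fun _ => h _

theorem transfer_le_of_nonneg (hM : ∀ᵐ ω ∂ν, ∀ i j, 0 ≤ M ω i j)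
    (h : ∀ x, 0 ≤ x → f x ≤ g x) {x : Fin d → ℝ} (hx : 0 ≤ x) :
    transfer ν M f x ≤ transfer ν M g x :=
  lintegral_mono_ae (hM.mono fun _ hω => h _ (mulVec_nonneg hω hx))

theorem transfer_iterate_le_of_nonneg (hM : ∀ᵐ ω ∂ν, ∀ i j, 0 ≤ M ω i j)
    (h : ∀ x, 0 ≤ x → f x ≤ g x) (k : ℕ) {x : Fin d → ℝ} (hx : 0 ≤ x) :
    (transfer ν M)^[k] f x ≤ (transfer ν M)^[k] g x := by
  induction k generalizing x with
  | zero => exact h x hx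
  | succ k ih =>
    rw [Function.iterate_succ_apply', Function.iterate_succ_apply']
    exact transfer_le_of_nonneg hM (fun _ => ih) hx

theorem antitoneOn_transfer (hM : ∀ᵐ ω ∂ν, ∀ i j, 0 ≤ M ω i j)
    (hf : AntitoneOn f (Set.Ici 0)) : AntitoneOn (transfer ν M f) (Set.Ici 0) :=
  fun _ hx _ hy hxy => lintegral_mono_ae (hM.mono fun _ hω =>
    hf (mulVec_nonneg hω hx) (mulVec_nonneg hω hy) (mulVec_mono hω hxy))

theorem antitoneOn_transfer_iterate (hM : ∀ᵐ ω ∂ν, ∀ i j, 0 ≤ M ω i j)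
    (hf : AntitoneOn f (Set.Ici 0)) (k : ℕ) :
    AntitoneOn ((transfer ν M)^[k] f) (Set.Ici 0) :=
  Function.Iterate.rec (fun f => AntitoneOn f (Set.Ici 0)) hf (fun _ => antitoneOn_transfer hM) k

theorem transfer_const_mul (hM : ∀ i j, Measurable fun ω => M ω i j) (hf : Measurable f)
    (C : ℝ≥0∞) : transfer ν M (fun x => C * f x) = fun x => C * transfer ν M f x :=
  funext fun _ =>
    lintegral_const_mul _ (hf.comp (measurable_mulVec hM measurable_const))

theorem transfer_iterate_const_mul [SFinite ν] (hM : ∀ i j, Measurable fun ω => M ω i j)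
    (hf : Measurable f) (C : ℝ≥0∞) (k : ℕ) :
    (transfer ν M)^[k] (fun x => C * f x) = fun x => C * (transfer ν M)^[k] f x := by
  induction k with
  | zero => rfl
  | succ k ih =>
    simp only [Function.iterate_succ_apply', ih]
    exact transfer_const_mul hM (measurable_transfer_iterate hM hf k) C

theorem transfer_smul_measure_iterate [SFinite ν] (hM : ∀ i j, Measurable fun ω => M ω i j)
    (hf : Measurable f) (r : ℝ≥0∞) (k : ℕ) :
    (transfer (r • ν) M)^[k] f = fun x => r ^ k * (transfer ν M)^[k] f x := by
  induction k with
  | zero => simp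
  | succ k ih =>
    have hsmul : ∀ g, transfer (r • ν) M g = fun x => r * transfer ν M g x := fun g =>
      funext fun x => lintegral_smul_measure _ _
    simp only [Function.iterate_succ_apply', ih, hsmul, pow_succ', mul_assoc]
    rw [transfer_const_mul hM (measurable_transfer_iterate hM hf k)]

theorem transfer_tsum (hM : ∀ i j, Measurable fun ω => M ω i j)
    {F : ℕ → (Fin d → ℝ) → ℝ≥0∞} (hF : ∀ k, Measurable (F k)) (x : Fin d → ℝ) :
    transfer ν M (fun y => ∑' k, F k y) x = ∑' k, transfer ν M (F k) x :=
  lintegral_tsum fun k => ((hF k).comp (measurable_mulVec hM measurable_const)).aemeasurable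

end Transfer

section Products

variable {Ω : Type*} {d : ℕ} {M : Ω → Matrix (Fin d) (Fin d) ℝ} {n : ℕ}

/-- The product `M (w (n - 1)) * ⋯ * M (w 0)`. -/
noncomputable def revProd (M : Ω → Matrix (Fin d) (Fin d) ℝ) (n : ℕ) (w : Fin n → Ω) :
    Matrix (Fin d) (Fin d) ℝ := (List.ofFn fun k : Fin n => M (w k.rev)).prod

theorem revProd_zero (M : Ω → Matrix (Fin d) (Fin d) ℝ) (w : Fin 0 → Ω) : revProd M 0 w = 1 := by
  simp [revProd]

theorem revProd_succ (M : Ω → Matrix (Fin d) (Fin d) ℝ) (w : Fin (n + 1) → Ω) :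
    revProd M (n + 1) w = revProd M n (Fin.tail w) * M (w 0) := by
  rw [revProd, List.ofFn_succ', List.concat_eq_append, List.prod_append]
  simp [revProd, Fin.rev_castSucc, Fin.tail]

theorem revProd_nonneg {w : Fin n → Ω} (hw : ∀ l i j, 0 ≤ M (w l) i j) (i j : Fin d) :
    0 ≤ revProd M n w i j := by
  induction n generalizing i j with
  | zero => rw [revProd_zero, Matrix.one_apply]; positivity
  | succ n ih =>
    rw [revProd_succ, Matrix.mul_apply]
    exact Finset.sum_nonneg fun k _ => mul_nonneg (ih (fun l => hw l.succ) i k) (hw 0 k j)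

theorem opNorm_revProd_mul_vecNorm_le [NeZero d] {c : ℝ} (hc : 1 ≤ c) {w : Fin n → Ω}
    (hw0 : ∀ l i j, 0 ≤ M (w l) i j) (hw : ∀ l, RowComparable c (M (w l))) {x : Fin d → ℝ}
    (hx : 0 ≤ x) :
    opNorm (revProd M n w) * vecNorm x ≤ c * vecNorm (revProd M n w *ᵥ x) := by
  cases n with
  | zero =>
    rw [revProd_zero, opNorm_one, Matrix.one_mulVec]
    exact mul_le_mul_of_nonneg_right hc (vecNorm_nonneg x)
  | succ n =>
    refine RowComparable.opNorm_mul_vecNorm_le (zero_le_one.trans hc) ?_ (revProd_nonneg hw0) hx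
    rw [revProd_succ]
    exact (hw 0).mul_left (revProd_nonneg fun l => hw0 l.succ)

variable [MeasurableSpace Ω]

theorem measurable_revProd (hM : ∀ i j, Measurable fun ω => M ω i j) (n : ℕ) (i j : Fin d) :
    Measurable fun w : Fin n → Ω => revProd M n w i j := by
  induction n generalizing i j with
  | zero => simp only [revProd_zero]; exact measurable_const
  | succ n ih =>
    simp only [revProd_succ, Matrix.mul_apply]
    exact Finset.measurable_fun_sum _ fun k _ =>
      ((ih i k).comp (measurable_pi_lambda _ fun l => measurable_pi_apply l.succ)).mul
        ((hM k j).comp (measurable_pi_apply 0))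

variable {ν : Measure Ω} [SigmaFinite ν]

theorem transfer_iterate_eq_lintegral_pi (hM : ∀ i j, Measurable fun ω => M ω i j)
    {f : (Fin d → ℝ) → ℝ≥0∞} (hf : Measurable f) (n : ℕ) (x : Fin d → ℝ) :
    (transfer ν M)^[n] f x =
      ∫⁻ w, f (revProd M n w *ᵥ x) ∂(Measure.pi fun _ : Fin n => ν) := by
  induction n generalizing x with
  | zero => simp [revProd_zero]
  | succ n ih =>
    have hmp := measurePreserving_piFinSuccAbove (fun _ : Fin (n + 1) => ν) 0
    have hF : Measurable fun p : Ω × (Fin n → Ω) => f (revProd M n p.2 *ᵥ (M p.1 *ᵥ x)) :=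
      hf.comp (measurable_mulVec
        (fun i j => (measurable_revProd hM n i j).comp measurable_snd)
        (measurable_mulVec (fun i j => (hM i j).comp measurable_fst) measurable_const))
    calc (transfer ν M)^[n + 1] f x
        = ∫⁻ ω, (transfer ν M)^[n] f (M ω *ᵥ x) ∂ν := by
          rw [Function.iterate_succ_apply']; rfl
      _ = ∫⁻ ω, ∫⁻ w, f (revProd M n w *ᵥ (M ω *ᵥ x)) ∂(Measure.pi fun _ : Fin n => ν) ∂ν := by
          simp only [ih]
      _ = ∫⁻ p, f (revProd M n p.2 *ᵥ (M p.1 *ᵥ x)) ∂(ν.prod (Measure.pi fun _ : Fin n => ν)) :=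
          (lintegral_prod _ hF.aemeasurable).symm
      _ = ∫⁻ w, f (revProd M (n + 1) w *ᵥ x) ∂(Measure.pi fun _ : Fin (n + 1) => ν) := by
          rw [← hmp.lintegral_comp hF]
          refine lintegral_congr fun w => ?_
          rw [revProd_succ, ← Matrix.mulVec_mulVec]
          rfl

theorem ae_pi_forall_of_ae {p : Ω → Prop} (h : ∀ᵐ ω ∂ν, p ω) :
    ∀ᵐ w ∂(Measure.pi fun _ : Fin n => ν), ∀ i, p (w i) :=
  eventually_all.2 fun i => (Measure.tendsto_eval_ae_ae (i := i)).eventually h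

end Products

section GrowthRate

variable {Ω : Type*} [MeasurableSpace Ω] {d : ℕ} {ν : Measure Ω}
  {M : Ω → Matrix (Fin d) (Fin d) ℝ} {a c : ℝ}

/-- The moment `E[‖M_n ⋯ M_1‖ ^ (-a)]` for independent `M_1, …, M_n` distributed as `M`
under `ν`. -/
noncomputable def prodMoment (ν : Measure Ω) (M : Ω → Matrix (Fin d) (Fin d) ℝ) (a : ℝ)
    (n : ℕ) : ℝ≥0∞ :=
  matMoment (Measure.pi fun _ : Fin n => ν) (revProd M n) (-a)

theorem prodMoment_zero [NeZero d] : prodMoment ν M a 0 = 1 := by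
  simp [prodMoment, matMoment, revProd_zero, opNorm_one]

theorem prodMoment_one (hM : ∀ i j, Measurable fun ω => M ω i j) :
    prodMoment ν M a 1 = matMoment ν M (-a) := by
  have h := (measurePreserving_funUnique ν (Fin 1)).lintegral_comp (measurable_opNorm_rpow hM (-a))
  simp only [prodMoment, matMoment, revProd, List.ofFn_succ, List.ofFn_zero, List.prod_singleton]
  convert h using 6
  rfl

theorem matMoment_neg_ne_zero [NeZero ν] (ha : 0 < a) (hM : ∀ i j, Measurable fun ω => M ω i j) :
    matMoment ν M (-a) ≠ 0 :=
  lintegral_ne_zero (measurable_opNorm_rpow hM _) fun _ => ofReal_rpow_neg_ne_zero ha _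

theorem prodMoment_mul_negPow_le [SigmaFinite ν] (ha : 0 ≤ a)
    (hM : ∀ i j, Measurable fun ω => M ω i j) (n : ℕ) (x : Fin d → ℝ) :
    prodMoment ν M a n * negPow a x ≤ (transfer ν M)^[n] (negPow a) x := by
  rw [transfer_iterate_eq_lintegral_pi hM (measurable_negPow a), prodMoment, matMoment,
    ← lintegral_mul_const _ (measurable_opNorm_rpow (measurable_revProd hM n) _)]
  exact lintegral_mono fun w => le_negPow_mulVec ha _ _

theorem transfer_iterate_negPow_le [NeZero d] [SigmaFinite ν] (ha : 0 ≤ a) (hc : 1 ≤ c)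
    (hM : ∀ i j, Measurable fun ω => M ω i j) (hM0 : ∀ᵐ ω ∂ν, ∀ i j, 0 ≤ M ω i j)
    (hMc : ∀ᵐ ω ∂ν, RowComparable c (M ω)) (n : ℕ) {x : Fin d → ℝ} (hx : 0 ≤ x) :
    (transfer ν M)^[n] (negPow a) x ≤
      ENNReal.ofReal c ^ a * (prodMoment ν M a n * negPow a x) := by
  have hmeas := measurable_opNorm_rpow (measurable_revProd hM n) (-a)
  rw [transfer_iterate_eq_lintegral_pi hM (measurable_negPow a), prodMoment, matMoment,
    ← lintegral_mul_const _ hmeas, ← lintegral_const_mul _ (hmeas.mul_const _)]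
  refine lintegral_mono_ae ?_
  filter_upwards [ae_pi_forall_of_ae hM0, ae_pi_forall_of_ae hMc] with w hw0 hw
  exact negPow_mulVec_le ha (one_pos.trans_le hc) (opNorm_revProd_mul_vecNorm_le hc hw0 hw hx)

theorem exists_nonneg_negPow_eq_one [NeZero d] (a : ℝ) :
    ∃ e : Fin d → ℝ, 0 ≤ e ∧ negPow a e = 1 :=
  ⟨Pi.single 0 1, Pi.single_nonneg.2 zero_le_one, by
    simp [negPow, vecNorm, Pi.single_apply, apply_ite abs]⟩

theorem prodMoment_add_le [NeZero d] [SigmaFinite ν] (ha : 0 ≤ a) (hc : 1 ≤ c)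
    (hM : ∀ i j, Measurable fun ω => M ω i j) (hM0 : ∀ᵐ ω ∂ν, ∀ i j, 0 ≤ M ω i j)
    (hMc : ∀ᵐ ω ∂ν, RowComparable c (M ω)) (m n : ℕ) :
    prodMoment ν M a (m + n) ≤
      (ENNReal.ofReal c ^ a) ^ 2 * (prodMoment ν M a m * prodMoment ν M a n) := by
  obtain ⟨e, he0, he⟩ := exists_nonneg_negPow_eq_one (d := d) a
  set L : ℝ≥0∞ := ENNReal.ofReal c ^ a
  set T := transfer ν M
  have hupp : ∀ k x, 0 ≤ x → T^[k] (negPow a) x ≤ L * prodMoment ν M a k * negPow a x :=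
    fun k x hx => (transfer_iterate_negPow_le ha hc hM hM0 hMc k hx).trans_eq (mul_assoc _ _ _).symm
  calc prodMoment ν M a (m + n) = prodMoment ν M a (m + n) * negPow a e := by rw [he, mul_one]
    _ ≤ T^[m] (T^[n] (negPow a)) e := by
      rw [← Function.iterate_add_apply]
      exact prodMoment_mul_negPow_le ha hM (m + n) e
    _ ≤ T^[m] (fun x => L * prodMoment ν M a n * negPow a x) e :=
      transfer_iterate_le_of_nonneg hM0 (hupp n) m he0
    _ = L * prodMoment ν M a n * T^[m] (negPow a) e := by
      rw [transfer_iterate_const_mul hM (measurable_negPow a)]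
    _ ≤ L * prodMoment ν M a n * (L * prodMoment ν M a m * negPow a e) := by
      gcongr
      exact hupp m e he0
    _ = L ^ 2 * (prodMoment ν M a m * prodMoment ν M a n) := by rw [he]; ring

theorem prodMoment_mul_le [NeZero d] [SigmaFinite ν] (ha : 0 ≤ a) (hc : 1 ≤ c)
    (hM : ∀ i j, Measurable fun ω => M ω i j) (hM0 : ∀ᵐ ω ∂ν, ∀ i j, 0 ≤ M ω i j)
    (hMc : ∀ᵐ ω ∂ν, RowComparable c (M ω)) (m n : ℕ) :
    prodMoment ν M a m * prodMoment ν M a n ≤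
      ENNReal.ofReal c ^ a * prodMoment ν M a (m + n) := by
  obtain ⟨e, he0, he⟩ := exists_nonneg_negPow_eq_one (d := d) a
  set T := transfer ν M
  have hlow : ∀ k x, prodMoment ν M a k * negPow a x ≤ T^[k] (negPow a) x :=
    prodMoment_mul_negPow_le ha hM
  calc prodMoment ν M a m * prodMoment ν M a n
      = prodMoment ν M a n * (prodMoment ν M a m * negPow a e) := by rw [he, mul_one, mul_comm]
    _ ≤ prodMoment ν M a n * T^[m] (negPow a) e := by gcongr; exact hlow m e
    _ = T^[m] (fun x => prodMoment ν M a n * negPow a x) e := by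
      rw [transfer_iterate_const_mul hM (measurable_negPow a)]
    _ ≤ T^[m] (T^[n] (negPow a)) e := (transfer_mono ν M).iterate m (hlow n) e
    _ ≤ ENNReal.ofReal c ^ a * (prodMoment ν M a (m + n) * negPow a e) := by
      rw [← Function.iterate_add_apply]
      exact transfer_iterate_negPow_le ha hc hM hM0 hMc (m + n) he0
    _ = ENNReal.ofReal c ^ a * prodMoment ν M a (m + n) := by rw [he, mul_one]

/-- The number `θ` is the growth rate of the iterates of the transfer operator on `|·| ^ (-a)`:
up to a constant factor, they multiply this function by `θ ^ k`. The upper bound is required on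
the nonnegative cone only. -/
def HasGrowthRate (ν : Measure Ω) (M : Ω → Matrix (Fin d) (Fin d) ℝ) (a : ℝ) (θ : ℝ≥0∞) : Prop :=
  ∃ K : ℝ≥0∞, K ≠ ∞ ∧ ∀ (k : ℕ) (x : Fin d → ℝ),
    (0 ≤ x → (transfer ν M)^[k] (negPow a) x ≤ K * (θ ^ k * negPow a x)) ∧
      θ ^ k * negPow a x ≤ K * (transfer ν M)^[k] (negPow a) x

theorem hasGrowthRate_zero_measure : HasGrowthRate (0 : Measure Ω) M a 0 := by
  refine ⟨1, ENNReal.one_ne_top, fun k x => ?_⟩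
  cases k with
  | zero => simp
  | succ k => simp [Function.iterate_succ_apply', transfer]

theorem HasGrowthRate.smul_measure [SFinite ν] (hM : ∀ i j, Measurable fun ω => M ω i j)
    {θ : ℝ≥0∞} (h : HasGrowthRate ν M a θ) (r : ℝ≥0∞) : HasGrowthRate (r • ν) M a (r * θ) := by
  obtain ⟨K, hK, hθ⟩ := h
  refine ⟨K, hK, fun k x => ?_⟩
  simp only [transfer_smul_measure_iterate hM (measurable_negPow a), mul_pow, mul_assoc,
    mul_left_comm K (r ^ k)]
  exact ⟨fun hx => mul_le_mul_right ((hθ k x).1 hx) _, mul_le_mul_right (hθ k x).2 _⟩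

theorem exists_hasGrowthRate [NeZero d] [IsProbabilityMeasure ν] (ha : 0 < a) (hc : 1 ≤ c)
    (hM : ∀ i j, Measurable fun ω => M ω i j) (hM0 : ∀ᵐ ω ∂ν, ∀ i j, 0 ≤ M ω i j)
    (hMc : ∀ᵐ ω ∂ν, RowComparable c (M ω)) (hmom : matMoment ν M (-a) ≠ ∞) :
    ∃ κ : ℝ≥0∞, κ ≠ 0 ∧ κ ≠ ∞ ∧ HasGrowthRate ν M a κ ∧
      Tendsto (fun n : ℕ => prodMoment ν M a n ^ ((n : ℝ)⁻¹)) atTop (𝓝 κ) := by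
  set L : ℝ≥0∞ := ENNReal.ofReal c ^ a
  have hL : L ≠ ∞ := ENNReal.rpow_ne_top_of_nonneg ha.le ENNReal.ofReal_ne_top
  have hL1 : 1 ≤ L := ENNReal.one_le_rpow (by simpa using hc) ha
  have hLL : L ≤ L ^ 2 := le_self_pow₀ hL1 two_ne_zero
  have hK : L ^ 2 ≠ ∞ := ENNReal.pow_ne_top hL
  have hK0 : L ^ 2 ≠ 0 := pow_ne_zero _ (one_pos.trans_le hL1).ne'
  obtain ⟨κ, hκ⟩ := exists_le_mul_pow_and_pow_le_mul hK prodMoment_zero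
    (prodMoment_add_le ha.le hc hM hM0 hMc)
    fun m n => (prodMoment_mul_le ha.le hc hM hM0 hMc m n).trans (by gcongr)
  have hκ1 := hκ 1
  rw [prodMoment_one hM, pow_one] at hκ1
  refine ⟨κ, ?_, ?_, ⟨L * L ^ 2, ENNReal.mul_ne_top hL hK, fun k x => ⟨fun hx => ?_, ?_⟩⟩,
    tendsto_rpow_inv_of_le_mul_pow hK0 hK (fun n => (hκ n).1) fun n => (hκ n).2⟩
  · rintro rfl
    exact matMoment_neg_ne_zero ha hM (by simpa using hκ1.1)
  · exact ne_top_of_le_ne_top (ENNReal.mul_ne_top hK hmom) hκ1.2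
  · calc (transfer ν M)^[k] (negPow a) x ≤ L * (prodMoment ν M a k * negPow a x) :=
          transfer_iterate_negPow_le ha.le hc hM hM0 hMc k hx
      _ ≤ L * (L ^ 2 * κ ^ k * negPow a x) := by gcongr; exact (hκ k).1
      _ = L * L ^ 2 * (κ ^ k * negPow a x) := by ring
  · calc κ ^ k * negPow a x ≤ L ^ 2 * prodMoment ν M a k * negPow a x := by
          gcongr; exact (hκ k).2
      _ = L ^ 2 * (prodMoment ν M a k * negPow a x) := mul_assoc _ _ _
      _ ≤ L * L ^ 2 * (transfer ν M)^[k] (negPow a) x := by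
          gcongr
          · exact le_mul_of_one_le_left zero_le hL1
          · exact prodMoment_mul_negPow_le ha.le hM k x

end GrowthRate

section SmoothSum

variable {Ω : Type*} {d : ℕ} {N : Ω → ℕ} {A : ℕ → Ω → Matrix (Fin d) (Fin d) ℝ}

/-- The random vector `∑_{i < N} A_i z_i` whose law under independent `z_i` is the smoothing
transform. -/
noncomputable def smoothSum (N : Ω → ℕ) (A : ℕ → Ω → Matrix (Fin d) (Fin d) ℝ)
    (p : Ω × (ℕ → Fin d → ℝ)) : Fin d → ℝ := ∑ i ∈ Finset.range (N p.1), A i p.1 *ᵥ p.2 i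

theorem mulVec_le_smoothSum {ω : Ω} {z : ℕ → Fin d → ℝ} (hA0 : ∀ i j k, 0 ≤ A i ω j k)
    (hz : ∀ i, 0 ≤ z i) {i : ℕ} (hi : i < N ω) : A i ω *ᵥ z i ≤ smoothSum N A (ω, z) :=
  Finset.single_le_sum (f := fun i => A i ω *ᵥ z i) (fun i _ => mulVec_nonneg (hA0 i) (hz i))
    (Finset.mem_range.2 hi)

variable [MeasurableSpace Ω]

theorem measurable_smoothSum (hN : Measurable N) (hA : ∀ i j k, Measurable fun ω => A i ω j k) :
    Measurable (smoothSum N A) := by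
  have h : Measurable fun q : (Ω × (ℕ → Fin d → ℝ)) × ℕ =>
      ∑ i ∈ Finset.range q.2, A i q.1.1 *ᵥ q.1.2 i :=
    measurable_from_prod_countable_left fun n =>
      Finset.measurable_fun_sum (Finset.range n) fun i _ =>
        (measurable_uncurry_mulVec (hA i)).comp
          (measurable_fst.prodMk ((measurable_pi_apply i).comp measurable_snd))
  exact h.comp (measurable_id.prodMk (hN.comp measurable_fst))

end SmoothSum

section FixedPoint

variable {Ω : Type*} [MeasurableSpace Ω] {d : ℕ} {P : Measure Ω} {N : Ω → ℕ}
  {A : ℕ → Ω → Matrix (Fin d) (Fin d) ℝ} {η : Measure (Fin d → ℝ)} [IsProbabilityMeasure η]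

theorem ae_pos_of_fixedPoint (hN : Measurable N) (hA : ∀ i j k, Measurable fun ω => A i ω j k)
    (hN1 : ∀ᵐ ω ∂P, 1 ≤ N ω) (hA0 : ∀ᵐ ω ∂P, ∀ i j k, 0 ≤ A i ω j k)
    (hpos : ∀ᵐ ω ∂P, ∀ i j, 0 < A 0 ω i j) (hfix : smoothingTransform P N A η = η)
    (hη : ∀ᵐ x ∂η, 0 ≤ x) (hη0 : ∀ᵐ x ∂η, x ≠ 0) : ∀ᵐ x ∂η, ∀ i, 0 < x i := by
  have hset : MeasurableSet {x : Fin d → ℝ | ∀ i, 0 < x i} := by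
    rw [Set.ofPred_forall]
    exact MeasurableSet.iInter fun i => measurableSet_lt measurable_const (measurable_pi_apply i)
  have hfst := Measure.quasiMeasurePreserving_fst (μ := P)
    (ν := Measure.infinitePi fun _ : ℕ => η)
  have hsnd := Measure.quasiMeasurePreserving_snd (μ := P)
    (ν := Measure.infinitePi fun _ : ℕ => η)
  rw [← hfix]
  refine (ae_map_iff (measurable_smoothSum hN hA).aemeasurable hset).2 ?_
  filter_upwards [hfst.ae hN1, hfst.ae hA0, hfst.ae hpos, hsnd.ae (ae_infinitePi_forall hη),
    hsnd.ae (ae_infinitePi_forall hη0)] with ⟨ω, z⟩ hNω hA0ω hposω hz hz0 i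
  exact (mulVec_pos hposω (hz 0) (hz0 0) i).trans_le (mulVec_le_smoothSum hA0ω hz hNω i)

theorem lintegral_eq_of_fixedPoint [SFinite P] (hN : Measurable N)
    (hA : ∀ i j k, Measurable fun ω => A i ω j k) (hfix : smoothingTransform P N A η = η)
    {f : (Fin d → ℝ) → ℝ≥0∞} (hf : Measurable f) :
    ∫⁻ x, f x ∂η = ∫⁻ x, transfer (P.restrict {ω | N ω = 1}) (A 0) f x ∂η +
      ∫⁻ ω in {ω | N ω = 1}ᶜ, ∫⁻ z, f (smoothSum N A (ω, z))
        ∂(Measure.infinitePi fun _ : ℕ => η) ∂P := by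
  have hS : MeasurableSet {ω | N ω = 1} := hN (measurableSet_singleton 1)
  have hsm := measurable_smoothSum hN hA
  have hAx := hf.comp (measurable_uncurry_mulVec (hA 0))
  have hiter : ∫⁻ x, f x ∂η = ∫⁻ ω, ∫⁻ z, f (smoothSum N A (ω, z))
      ∂(Measure.infinitePi fun _ : ℕ => η) ∂P :=
    calc ∫⁻ x, f x ∂η = ∫⁻ x, f x ∂(smoothingTransform P N A η) := by rw [hfix]
      _ = ∫⁻ p, f (smoothSum N A p) ∂(P.prod (Measure.infinitePi fun _ : ℕ => η)) :=
        lintegral_map hf hsm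
      _ = _ := lintegral_prod _ (hf.comp hsm).aemeasurable
  rw [hiter, ← lintegral_add_compl _ hS]
  congr 1
  calc ∫⁻ ω in {ω | N ω = 1}, ∫⁻ z, f (smoothSum N A (ω, z))
        ∂(Measure.infinitePi fun _ : ℕ => η) ∂P
      = ∫⁻ ω in {ω | N ω = 1}, ∫⁻ x, f (A 0 ω *ᵥ x) ∂η ∂P := by
        refine setLIntegral_congr_fun hS fun ω (hω : N ω = 1) => ?_
        simp only [smoothSum, hω, Finset.range_one, Finset.sum_singleton]
        exact lintegral_infinitePi_eval (hAx.comp measurable_prodMk_left) 0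
    _ = ∫⁻ x, transfer (P.restrict {ω | N ω = 1}) (A 0) f x ∂η :=
        lintegral_lintegral_swap hAx.aemeasurable

end FixedPoint

section Divergence

theorem eq_top_of_forall_succ_add_le {v : ℕ → ℝ≥0∞} {e : ℝ≥0∞} (he : e ≠ 0)
    (h : ∀ k, v (k + 1) + e ≤ v k) : v 0 = ∞ := by
  have hsum : ∀ n : ℕ, n * e ≤ v 0 := fun n => by
    suffices hv : v n + n * e ≤ v 0 from le_add_self.trans hv
    induction n with
    | zero => simp
    | succ n ih =>
      calc v (n + 1) + (n + 1 : ℕ) * e = v (n + 1) + e + n * e := by push_cast; ring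
        _ ≤ v n + n * e := by gcongr; exact h n
        _ ≤ v 0 := ih
  by_contra hne
  obtain ⟨n, hn⟩ := ENNReal.exists_nat_mul_gt he hne
  exact (hsum n).not_gt hn

variable {Ω : Type*} [MeasurableSpace Ω] {d : ℕ} {P : Measure Ω} [SFinite P] {N : Ω → ℕ}
  {A : ℕ → Ω → Matrix (Fin d) (Fin d) ℝ} {η : Measure (Fin d → ℝ)} [IsProbabilityMeasure η]
  {a : ℝ}

/-- By the fixed point equation, the `η`-integrals of `T^k |·| ^ (-a)` decrease in every step by at
least a fixed positive amount, which stems from the event `N ≠ 1`. -/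
theorem lintegral_negPow_eq_top (hN : Measurable N) (hA : ∀ i j k, Measurable fun ω => A i ω j k)
    (hfix : smoothingTransform P N A η = η) (ha : 0 < a) (hP : P {ω | N ω = 1}ᶜ ≠ 0)
    {b : ℝ≥0∞} (hb0 : b ≠ 0) (hb : ∀ k x,
      b * negPow a x ≤ (transfer (P.restrict {ω | N ω = 1}) (A 0))^[k] (negPow a) x) :
    ∫⁻ x, negPow a x ∂η = ∞ := by
  set T := transfer (P.restrict {ω | N ω = 1}) (A 0)
  have hmeas : Measurable fun p => negPow a (smoothSum N A p) :=
    (measurable_negPow a).comp (measurable_smoothSum hN hA)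
  set R : Ω → ℝ≥0∞ := fun ω => ∫⁻ z, negPow a (smoothSum N A (ω, z))
    ∂(Measure.infinitePi fun _ : ℕ => η)
  have hRm : Measurable R := hmeas.lintegral_prod_right'
  have : NeZero (P.restrict {ω | N ω = 1}ᶜ) := ⟨mt Measure.restrict_eq_zero.1 hP⟩
  have hR0 : ∫⁻ ω in {ω | N ω = 1}ᶜ, R ω ∂P ≠ 0 :=
    lintegral_ne_zero hRm fun ω => lintegral_ne_zero (hmeas.comp measurable_prodMk_left)
      fun z => ofReal_rpow_neg_ne_zero ha _
  refine eq_top_of_forall_succ_add_le (v := fun k => ∫⁻ x, T^[k] (negPow a) x ∂η)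
    (mul_ne_zero hb0 hR0) fun k => ?_
  have hTm := measurable_transfer_iterate (ν := P.restrict {ω | N ω = 1}) (hA 0)
    (measurable_negPow a) k
  simp only [Function.iterate_succ_apply']
  rw [lintegral_eq_of_fixedPoint hN hA hfix hTm, ← lintegral_const_mul _ hRm]
  gcongr with ω
  refine (lintegral_const_mul b (hmeas.comp measurable_prodMk_left)).symm.trans_le ?_
  exact lintegral_mono fun z => hb k _

end Divergence

section Lyapunov

variable {Ω : Type*} [MeasurableSpace Ω] {d : ℕ} {ν : Measure Ω}
  {M : Ω → Matrix (Fin d) (Fin d) ℝ} {a c : ℝ} {f V : (Fin d → ℝ) → ℝ≥0∞} {x : Fin d → ℝ}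
  {r ρ θ C : ℝ≥0∞}

/-- A Lyapunov function for the transfer operator of `M` under `ν`: on the nonnegative cone it is
nonincreasing and at most `C` times `|·| ^ (-a)`, it dominates `|·| ^ (-a)` everywhere, and the
operator contracts it by the factor `ρ`. -/
structure IsLyapunov (ν : Measure Ω) (M : Ω → Matrix (Fin d) (Fin d) ℝ) (a : ℝ) (ρ C : ℝ≥0∞)
    (V : (Fin d → ℝ) → ℝ≥0∞) : Prop where
  measurable : Measurable V
  antitoneOn : AntitoneOn V (Set.Ici 0)
  negPow_le : ∀ x, negPow a x ≤ V x
  le_mul_negPow : ∀ x, 0 ≤ x → V x ≤ C * negPow a x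
  transfer_le : ∀ x, transfer ν M V x ≤ ρ * V x

/-- The weighted Green function `∑ k, r ^ k T ^ k f` of the transfer operator `T`. -/
noncomputable def green (ν : Measure Ω) (M : Ω → Matrix (Fin d) (Fin d) ℝ) (r : ℝ≥0∞)
    (f : (Fin d → ℝ) → ℝ≥0∞) (x : Fin d → ℝ) : ℝ≥0∞ := ∑' k, r ^ k * (transfer ν M)^[k] f x

theorem measurable_green [SFinite ν] (hM : ∀ i j, Measurable fun ω => M ω i j)
    (hf : Measurable f) : Measurable (green ν M r f) :=
  Measurable.tsum fun k => (measurable_transfer_iterate hM hf k).const_mul _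

theorem antitoneOn_green (hM0 : ∀ᵐ ω ∂ν, ∀ i j, 0 ≤ M ω i j) (hf : AntitoneOn f (Set.Ici 0)) :
    AntitoneOn (green ν M r f) (Set.Ici 0) := fun _ hx _ hy hxy =>
  ENNReal.tsum_le_tsum fun k =>
    mul_le_mul_right (antitoneOn_transfer_iterate hM0 hf k hx hy hxy) _

theorem le_green (x : Fin d → ℝ) : f x ≤ green ν M r f x := by
  simpa [green] using ENNReal.le_tsum (f := fun k => r ^ k * (transfer ν M)^[k] f x) 0

theorem mul_transfer_green_le [SFinite ν] (hM : ∀ i j, Measurable fun ω => M ω i j)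
    (hf : Measurable f) (x : Fin d → ℝ) :
    r * transfer ν M (green ν M r f) x ≤ green ν M r f x := by
  have hmeas := measurable_transfer_iterate (ν := ν) hM hf
  calc r * transfer ν M (green ν M r f) x
      = ∑' k, r ^ (k + 1) * (transfer ν M)^[k + 1] f x := by
        unfold green
        rw [transfer_tsum hM fun k => (hmeas k).const_mul _, ← ENNReal.tsum_mul_left]
        simp only [transfer_const_mul hM (hmeas _), Function.iterate_succ_apply', pow_succ',
          mul_assoc]
    _ ≤ green ν M r f x :=
        ENNReal.tsum_comp_le_tsum_of_injective (add_left_injective 1)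
          fun k => r ^ k * (transfer ν M)^[k] f x

theorem green_le_of_forall_iterate_le
    (h : ∀ k, (transfer ν M)^[k] f x ≤ C * (θ ^ k * f x)) :
    green ν M r f x ≤ C * (1 - r * θ)⁻¹ * f x := by
  calc green ν M r f x ≤ ∑' k, C * ((r * θ) ^ k * f x) := by
        refine ENNReal.tsum_le_tsum fun k => (mul_le_mul_right (h k) _).trans_eq ?_
        ring
    _ = C * (1 - r * θ)⁻¹ * f x := by
        rw [ENNReal.tsum_mul_left, ENNReal.tsum_mul_right, ENNReal.tsum_geometric, mul_assoc]

theorem HasGrowthRate.exists_isLyapunov [SFinite ν] (ha : 0 ≤ a)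
    (hM : ∀ i j, Measurable fun ω => M ω i j) (hM0 : ∀ᵐ ω ∂ν, ∀ i j, 0 ≤ M ω i j)
    (h : HasGrowthRate ν M a θ) (hθ : θ < 1) :
    ∃ (ρ C : ℝ≥0∞) (V : (Fin d → ℝ) → ℝ≥0∞), ρ < 1 ∧ C ≠ ∞ ∧ IsLyapunov ν M a ρ C V := by
  obtain ⟨K, hK, hgrowth⟩ := h
  obtain ⟨ρ, hθρ, hρ1⟩ := exists_between hθ
  have hρ0 : ρ ≠ 0 := (zero_le.trans_lt hθρ).ne'
  have hlt : ρ⁻¹ * θ < 1 := by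
    rw [mul_comm, ← div_eq_mul_inv]
    exact ENNReal.div_lt_of_lt_mul (by rwa [one_mul])
  refine ⟨ρ, K * (1 - ρ⁻¹ * θ)⁻¹, green ν M ρ⁻¹ (negPow a), hρ1,
    ENNReal.mul_ne_top hK (ENNReal.inv_ne_top.2 (tsub_pos_of_lt hlt).ne'),
    measurable_green hM (measurable_negPow a), antitoneOn_green hM0 (antitoneOn_negPow ha),
    le_green, fun x hx => green_le_of_forall_iterate_le fun k => (hgrowth k x).1 hx, fun x => ?_⟩
  rw [← ENNReal.inv_mul_le_iff hρ0 hρ1.ne_top]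
  exact mul_transfer_green_le hM (measurable_negPow a) x

theorem transfer_min_le (h : transfer ν M V x ≤ ρ * V x) (m : ℝ≥0∞) :
    transfer ν M (fun y => min (V y) m) x ≤ max ρ (ν Set.univ) * min (V x) m := by
  rw [mul_min]
  refine le_min ?_ ?_
  · calc transfer ν M (fun y => min (V y) m) x ≤ transfer ν M V x :=
          transfer_mono ν M (fun _ => min_le_left _ _) x
      _ ≤ max ρ (ν Set.univ) * V x := h.trans (by gcongr; exact le_max_left _ _)
  · calc transfer ν M (fun y => min (V y) m) x ≤ ∫⁻ _, m ∂ν :=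
          lintegral_mono fun _ => min_le_right _ _
      _ ≤ max ρ (ν Set.univ) * m := by
        rw [lintegral_const, mul_comm]
        gcongr
        exact le_max_right _ _

theorem IsLyapunov.mulVec_le (hV : IsLyapunov ν M a ρ C V) (ha : 0 ≤ a) (hc : 0 < c)
    {B : Matrix (Fin d) (Fin d) ℝ} (hB : ∀ i j, 0 ≤ B i j) (hBc : RowComparable c B)
    (hx : 0 ≤ x) :
    V (B *ᵥ x) ≤ C * (ENNReal.ofReal c ^ a * ENNReal.ofReal (opNorm B) ^ (-a)) * V x := by
  calc V (B *ᵥ x) ≤ C * negPow a (B *ᵥ x) := hV.le_mul_negPow _ (mulVec_nonneg hB hx)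
    _ ≤ C * (ENNReal.ofReal c ^ a * (ENNReal.ofReal (opNorm B) ^ (-a) * negPow a x)) := by
      gcongr
      exact negPow_mulVec_le ha hc (hBc.opNorm_mul_vecNorm_le hc.le hB hx)
    _ = C * (ENNReal.ofReal c ^ a * ENNReal.ofReal (opNorm B) ^ (-a)) * negPow a x := by ring
    _ ≤ C * (ENNReal.ofReal c ^ a * ENNReal.ofReal (opNorm B) ^ (-a)) * V x := by
      gcongr
      exact hV.negPow_le x

theorem IsLyapunov.exists_forall_min_mulVec_le {P : Measure Ω} [IsFiniteMeasure P]
    {B : Ω → Matrix (Fin d) (Fin d) ℝ} (hV : IsLyapunov ν M a ρ C V) (hC : C ≠ ∞) (ha : 0 ≤ a)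
    (hc : 0 < c) (hB : ∀ i j, Measurable fun ω => B ω i j) (hB0 : ∀ᵐ ω ∂P, ∀ i j, 0 ≤ B ω i j)
    (hBc : ∀ᵐ ω ∂P, RowComparable c (B ω)) (hmom : matMoment P B (-a) < ∞) :
    ∃ L : Ω → ℝ≥0∞, Measurable L ∧ ∫⁻ ω, L ω ∂P ≠ ∞ ∧
      ∀ᵐ ω ∂P, ∀ m x, 0 ≤ x → min (V (B ω *ᵥ x)) m ≤ L ω * min (V x) m := by
  have hopm := measurable_opNorm_rpow hB (-a)
  refine ⟨fun ω => max (C * (ENNReal.ofReal c ^ a * ENNReal.ofReal (opNorm (B ω)) ^ (-a))) 1,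
    ((hopm.const_mul _).const_mul _).max measurable_const, ?_, ?_⟩
  · refine ((lintegral_mono fun ω => max_le_add_of_nonneg zero_le zero_le).trans_lt ?_).ne
    rw [lintegral_add_right _ measurable_const, lintegral_const_mul _ (hopm.const_mul _),
      lintegral_const_mul _ hopm, lintegral_const, one_mul]
    exact ENNReal.add_lt_top.2 ⟨ENNReal.mul_lt_top hC.lt_top (ENNReal.mul_lt_top
      (ENNReal.rpow_lt_top_of_nonneg ha ENNReal.ofReal_ne_top) hmom), measure_lt_top _ _⟩
  · filter_upwards [hB0, hBc] with ω h0 h1 m x hx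
    rw [mul_min]
    exact min_le_min
      ((hV.mulVec_le ha hc h0 h1 hx).trans (mul_le_mul_left (le_max_left _ _) _))
      (le_mul_of_one_le_left zero_le (le_max_right _ _))

end Lyapunov

section Finiteness

theorem lintegral_lt_top_of_forall_lintegral_min_le {X : Type*} [MeasurableSpace X]
    {μ : Measure X} {V : X → ℝ≥0∞} (hV : Measurable V) {B : ℝ≥0∞} (hB : B ≠ ∞)
    (h : ∀ n : ℕ, ∫⁻ x, min (V x) n ∂μ ≤ B) : ∫⁻ x, V x ∂μ < ∞ :=
  calc ∫⁻ x, V x ∂μ = ∫⁻ x, ⨆ n : ℕ, min (V x) n ∂μ :=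
        lintegral_congr fun x => by
          rw [← inf_iSup_eq, ENNReal.iSup_natCast, inf_top_eq]
    _ = ⨆ n : ℕ, ∫⁻ x, min (V x) n ∂μ :=
        lintegral_iSup (fun _ => hV.min measurable_const) fun m n hmn x =>
          min_le_min_left _ (by exact_mod_cast hmn)
    _ < ∞ := (iSup_le h).trans_lt hB.lt_top

variable {Ω : Type*} {d : ℕ} {N : Ω → ℕ} {A : ℕ → Ω → Matrix (Fin d) (Fin d) ℝ}
  {η : Measure (Fin d → ℝ)} [IsProbabilityMeasure η]

/-- Either the second summand has norm at least `s`, or `f` is evaluated at a vector above the first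
summand, which is independent of the second. -/
theorem lintegral_smoothSum_le {ω : Ω} (hA0 : ∀ i j k, 0 ≤ A i ω j k) (hNω : 1 < N ω)
    (hη : ∀ᵐ x ∂η, 0 ≤ x) {f : (Fin d → ℝ) → ℝ≥0∞} (hf : Measurable f)
    (hanti : AntitoneOn f (Set.Ici 0)) {l D : ℝ≥0∞} {s : ℝ}
    (hl : ∀ x, 0 ≤ x → f (A 0 ω *ᵥ x) ≤ l * f x)
    (hD : ∀ y, 0 ≤ y → s ≤ vecNorm y → f y ≤ D) :
    ∫⁻ z, f (smoothSum N A (ω, z)) ∂(Measure.infinitePi fun _ : ℕ => η) ≤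
      l * η {y | vecNorm (A 1 ω *ᵥ y) < s} * ∫⁻ x, f x ∂η + D := by
  set E : Set (Fin d → ℝ) := {y | vecNorm (A 1 ω *ᵥ y) < s}
  have hE : MeasurableSet E := measurableSet_lt
    (measurable_vecNorm.comp (Continuous.matrix_mulVec continuous_const continuous_id).measurable)
    measurable_const
  have hEm : Measurable (E.indicator (1 : (Fin d → ℝ) → ℝ≥0∞)) := measurable_one.indicator hE
  have hprod : Measurable fun z : ℕ → Fin d → ℝ => E.indicator 1 (z 1) * f (z 0) :=
    (hEm.comp (measurable_pi_apply 1)).mul (hf.comp (measurable_pi_apply 0))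
  have hpoint : ∀ᵐ z ∂(Measure.infinitePi fun _ : ℕ => η),
      f (smoothSum N A (ω, z)) ≤ l * (E.indicator 1 (z 1) * f (z 0)) + D := by
    filter_upwards [ae_infinitePi_forall hη] with z hz
    have hle : ∀ i < N ω, f (smoothSum N A (ω, z)) ≤ f (A i ω *ᵥ z i) := fun i hi =>
      have hi0 : 0 ≤ A i ω *ᵥ z i := mulVec_nonneg (hA0 i) (hz i)
      have hiS := mulVec_le_smoothSum hA0 hz hi
      hanti hi0 (hi0.trans hiS) hiS
    by_cases hzE : z 1 ∈ E
    · rw [Set.indicator_of_mem hzE, Pi.one_apply, one_mul]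
      exact ((hle 0 (one_pos.trans hNω)).trans (hl _ (hz 0))).trans le_self_add
    · exact ((hle 1 hNω).trans
        (hD _ (mulVec_nonneg (hA0 1) (hz 1)) (not_lt.1 hzE))).trans le_add_self
  calc ∫⁻ z, f (smoothSum N A (ω, z)) ∂(Measure.infinitePi fun _ : ℕ => η)
      ≤ ∫⁻ z, (l * (E.indicator 1 (z 1) * f (z 0)) + D)
          ∂(Measure.infinitePi fun _ : ℕ => η) := lintegral_mono_ae hpoint
    _ = l * η E * ∫⁻ x, f x ∂η + D := by
      rw [lintegral_add_right _ measurable_const, lintegral_const_mul _ hprod,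
        lintegral_infinitePi_mul hEm hf one_ne_zero, lintegral_indicator_one hE, lintegral_const,
        measure_univ, mul_one, mul_assoc]

variable [MeasurableSpace Ω] {P : Measure Ω} {a c : ℝ} {ρ C : ℝ≥0∞} {L : Ω → ℝ≥0∞}
  {V : (Fin d → ℝ) → ℝ≥0∞}

theorem ae_restrict_compl_one_lt (hN : Measurable N) (hN1 : ∀ᵐ ω ∂P, 1 ≤ N ω) :
    ∀ᵐ ω ∂(P.restrict {ω | N ω = 1}ᶜ), 1 < N ω := by
  filter_upwards [ae_restrict_of_ae hN1,
    ae_restrict_mem (hN (measurableSet_singleton 1)).compl] with ω h1 h2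
  exact lt_of_le_of_ne h1 (Ne.symm h2)

theorem exists_setLIntegral_smoothSum_le [IsProbabilityMeasure P]
    (hA : ∀ i j k, Measurable fun ω => A i ω j k)
    (hN : Measurable N) (hN1 : ∀ᵐ ω ∂P, 1 ≤ N ω) (hA0 : ∀ᵐ ω ∂P, ∀ i j k, 0 ≤ A i ω j k)
    (hA1 : ∀ᵐ ω ∂P, 1 < N ω → A 1 ω ≠ 0) (hη : ∀ᵐ x ∂η, ∀ i, 0 < x i) (hL : Measurable L)
    (hLint : ∫⁻ ω, L ω ∂P ≠ ∞) (ha : 0 ≤ a) (hC : C ≠ ∞) {δ : ℝ≥0∞} (hδ : 0 < δ) :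
    ∃ D : ℝ≥0∞, D ≠ ∞ ∧ ∀ f : (Fin d → ℝ) → ℝ≥0∞, Measurable f → AntitoneOn f (Set.Ici 0) →
      (∀ x, 0 ≤ x → f x ≤ C * negPow a x) →
      (∀ᵐ ω ∂P, ∀ x, 0 ≤ x → f (A 0 ω *ᵥ x) ≤ L ω * f x) →
      ∫⁻ ω in {ω | N ω = 1}ᶜ, ∫⁻ z, f (smoothSum N A (ω, z))
        ∂(Measure.infinitePi fun _ : ℕ => η) ∂P ≤ δ * ∫⁻ x, f x ∂η + D := by
  have hNS := ae_restrict_compl_one_lt hN hN1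
  have hφ : Measurable fun p : Ω × (Fin d → ℝ) => vecNorm (A 1 p.1 *ᵥ p.2) :=
    measurable_vecNorm.comp (measurable_uncurry_mulVec (hA 1))
  have hφpos : ∀ᵐ ω ∂(P.restrict {ω | N ω = 1}ᶜ), ∀ᵐ y ∂η, 0 < vecNorm (A 1 ω *ᵥ y) := by
    filter_upwards [hNS, ae_restrict_of_ae hA0, ae_restrict_of_ae hA1] with ω h1 h2 h3
    exact hη.mono fun y hy => vecNorm_mulVec_pos (h2 1) (h3 h1) hy
  obtain ⟨s, hs, hsmall⟩ := exists_pos_lintegral_mul_measure_lt_lt hL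
    (ne_top_of_le_ne_top hLint (setLIntegral_le_lintegral _ _)) hφ hφpos hδ
  have hLs : Measurable fun ω => L ω * η {y | vecNorm (A 1 ω *ᵥ y) < s} :=
    hL.mul (measurable_measure_prodMk_left (measurableSet_lt hφ measurable_const))
  refine ⟨C * ENNReal.ofReal s ^ (-a), ENNReal.mul_ne_top hC
    (ENNReal.rpow_ne_top_of_ne_zero (by simpa using hs) ENNReal.ofReal_ne_top),
    fun f hf hanti hfC hfL => ?_⟩
  calc ∫⁻ ω in {ω | N ω = 1}ᶜ, ∫⁻ z, f (smoothSum N A (ω, z))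
        ∂(Measure.infinitePi fun _ : ℕ => η) ∂P
      ≤ ∫⁻ ω in {ω | N ω = 1}ᶜ, (L ω * η {y | vecNorm (A 1 ω *ᵥ y) < s} * ∫⁻ x, f x ∂η +
          C * ENNReal.ofReal s ^ (-a)) ∂P := by
        refine lintegral_mono_ae ?_
        filter_upwards [hNS, ae_restrict_of_ae hA0, ae_restrict_of_ae hfL] with ω h1 h2 h3
        exact lintegral_smoothSum_le h2 h1 (hη.mono fun x hx i => (hx i).le) hf hanti h3
          fun y hy hsy => (hfC y hy).trans (mul_le_mul_right (negPow_le_ofReal_rpow ha hsy) _)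
    _ ≤ δ * ∫⁻ x, f x ∂η + C * ENNReal.ofReal s ^ (-a) := by
        rw [lintegral_add_right _ measurable_const, lintegral_mul_const _ hLs, setLIntegral_const]
        exact add_le_add (mul_le_mul_left hsmall.le _) (mul_le_of_le_one_right' prob_le_one)

theorem IsLyapunov.lintegral_lt_top [IsProbabilityMeasure P]
    (hV : IsLyapunov (P.restrict {ω | N ω = 1}) (A 0) a ρ C V)
    (hρ : ρ < 1) (hC : C ≠ ∞) (ha : 0 ≤ a) (hA : ∀ i j k, Measurable fun ω => A i ω j k)
    (hN : Measurable N) (hN1 : ∀ᵐ ω ∂P, 1 ≤ N ω) (hp : P {ω | N ω = 1} < 1)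
    (hA0 : ∀ᵐ ω ∂P, ∀ i j k, 0 ≤ A i ω j k) (hA1 : ∀ᵐ ω ∂P, 1 < N ω → A 1 ω ≠ 0)
    (hc : 0 < c) (hAc : ∀ᵐ ω ∂P, RowComparable c (A 0 ω))
    (hmom : matMoment P (A 0) (-a) < ∞) (hfix : smoothingTransform P N A η = η)
    (hη : ∀ᵐ x ∂η, ∀ i, 0 < x i) : ∫⁻ x, V x ∂η < ∞ := by
  obtain ⟨L, hL, hLint, hVL⟩ := hV.exists_forall_min_mulVec_le hC ha hc (hA 0)
    (hA0.mono fun ω h => h 0) hAc hmom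
  set σ : ℝ≥0∞ := max ρ (P.restrict {ω | N ω = 1} Set.univ)
  have hσ : σ < 1 := max_lt hρ (by rwa [Measure.restrict_apply_univ])
  obtain ⟨t, hσt, ht1⟩ := exists_between hσ
  obtain ⟨D, hD, hbound⟩ := exists_setLIntegral_smoothSum_le hA hN hN1 hA0 hA1 hη hL hLint ha hC
    (tsub_pos_of_lt hσt)
  refine lintegral_lt_top_of_forall_lintegral_min_le hV.measurable
    (ENNReal.mul_ne_top (ENNReal.inv_ne_top.2 (tsub_pos_of_lt ht1).ne') hD) fun n =>
    le_inv_one_sub_mul_of_le_mul_add ?_ ht1 ?_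
  · exact ne_top_of_le_ne_top (by simp) (lintegral_mono fun x => min_le_right (V x) n)
  have hfm : Measurable fun x => min (V x) n := hV.measurable.min measurable_const
  calc ∫⁻ x, min (V x) n ∂η
      = ∫⁻ x, transfer (P.restrict {ω | N ω = 1}) (A 0) (fun y => min (V y) n) x ∂η +
          ∫⁻ ω in {ω | N ω = 1}ᶜ, ∫⁻ z, min (V (smoothSum N A (ω, z))) n
            ∂(Measure.infinitePi fun _ : ℕ => η) ∂P :=
        lintegral_eq_of_fixedPoint hN hA hfix hfm
    _ ≤ σ * ∫⁻ x, min (V x) n ∂η + ((t - σ) * ∫⁻ x, min (V x) n ∂η + D) := by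
        refine add_le_add ?_ (hbound _ hfm
          (fun x hx y hy hxy => min_le_min_right _ (hV.antitoneOn hx hy hxy))
          (fun x hx => (min_le_left _ _).trans (hV.le_mul_negPow x hx))
          (hVL.mono fun ω h => h n))
        rw [← lintegral_const_mul _ hfm]
        exact lintegral_mono fun x => transfer_min_le (hV.transfer_le x) n
    _ = t * ∫⁻ x, min (V x) n ∂η + D := by
        rw [← add_assoc, ← add_mul, add_tsub_cancel_of_le hσt.le]

end Finiteness

section Dichotomy

variable {Ω : Type*} [MeasurableSpace Ω] {d : ℕ} {P : Measure Ω} [IsProbabilityMeasure P]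
  {a c : ℝ}

theorem exists_hasGrowthRate_restrict [NeZero d] {S : Set Ω}
    {M : Ω → Matrix (Fin d) (Fin d) ℝ} (ha : 0 < a) (hc : 1 ≤ c)
    (hM : ∀ i j, Measurable fun ω => M ω i j) (hM0 : ∀ᵐ ω ∂P, ∀ i j, 0 ≤ M ω i j)
    (hMc : ∀ᵐ ω ∂P, RowComparable c (M ω)) (hmom : matMoment P M (-a) < ∞) (hS : 0 < P S) :
    ∃ κ : ℝ≥0∞, κ ≠ 0 ∧ κ ≠ ∞ ∧ HasGrowthRate (P.restrict S) M a (κ * P S) ∧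
      Tendsto (fun n : ℕ => prodMoment (cond P S) M a n ^ ((n : ℝ)⁻¹)) atTop (𝓝 κ) := by
  have := cond_isProbabilityMeasure hS.ne'
  have hrestrict : P.restrict S = P S • cond P S := by
    rw [ProbabilityTheory.cond, smul_smul, ENNReal.mul_inv_cancel hS.ne' (measure_ne_top _ _),
      one_smul]
  have hmomS : matMoment (cond P S) M (-a) ≠ ∞ := by
    rw [matMoment, ProbabilityTheory.cond, lintegral_smul_measure]
    exact ENNReal.mul_ne_top (ENNReal.inv_ne_top.2 hS.ne')
      ((setLIntegral_le_lintegral _ _).trans_lt hmom).ne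
  obtain ⟨κ, hκ0, hκ, hgrowth, hlim⟩ := exists_hasGrowthRate ha hc hM
    (cond_absolutelyContinuous.ae_le hM0) (cond_absolutelyContinuous.ae_le hMc) hmomS
  refine ⟨κ, hκ0, hκ, ?_, hlim⟩
  rw [hrestrict, mul_comm κ]
  exact hgrowth.smul_measure hM (P S)

variable {N : Ω → ℕ} {A : ℕ → Ω → Matrix (Fin d) (Fin d) ℝ} {η : Measure (Fin d → ℝ)}
  [IsProbabilityMeasure η] {θ : ℝ≥0∞}

theorem HasGrowthRate.lintegral_negPow_eq_top
    (h : HasGrowthRate (P.restrict {ω | N ω = 1}) (A 0) a θ) (hθ : 1 ≤ θ) (ha : 0 < a)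
    (hA : ∀ i j k, Measurable fun ω => A i ω j k) (hN : Measurable N)
    (hp : P {ω | N ω = 1} < 1) (hfix : smoothingTransform P N A η = η) :
    ∫⁻ x, negPow a x ∂η = ∞ := by
  obtain ⟨K, hK, hgrowth⟩ := h
  have hcompl : P {ω | N ω = 1}ᶜ ≠ 0 :=
    (prob_compl_eq_zero_iff (hN (measurableSet_singleton 1))).not.2 hp.ne
  refine Smoothing.lintegral_negPow_eq_top hN hA hfix ha hcompl (ENNReal.inv_ne_zero.2 hK)
    fun k x => ?_
  have hle : negPow a x ≤ K * (transfer (P.restrict {ω | N ω = 1}) (A 0))^[k] (negPow a) x :=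
    (le_mul_of_one_le_left zero_le (one_le_pow₀ hθ)).trans (hgrowth k x).2
  rw [mul_comm, ← div_eq_mul_inv]
  exact ENNReal.div_le_of_le_mul' hle

theorem HasGrowthRate.lintegral_negPow_lt_top_iff
    (h : HasGrowthRate (P.restrict {ω | N ω = 1}) (A 0) a θ) (ha : 0 < a)
    (hA : ∀ i j k, Measurable fun ω => A i ω j k) (hN : Measurable N) (hN1 : ∀ᵐ ω ∂P, 1 ≤ N ω)
    (hp : P {ω | N ω = 1} < 1) (hA0 : ∀ᵐ ω ∂P, ∀ i j k, 0 ≤ A i ω j k)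
    (hA1 : ∀ᵐ ω ∂P, 1 < N ω → A 1 ω ≠ 0) (hc : 0 < c)
    (hAc : ∀ᵐ ω ∂P, RowComparable c (A 0 ω)) (hmom : matMoment P (A 0) (-a) < ∞)
    (hfix : smoothingTransform P N A η = η) (hη : ∀ᵐ x ∂η, ∀ i, 0 < x i) :
    ∫⁻ x, negPow a x ∂η < ∞ ↔ θ < 1 := by
  refine ⟨fun hfin => ?_, fun hθ => ?_⟩
  · by_contra! hθ
    exact hfin.ne (h.lintegral_negPow_eq_top hθ ha hA hN hp hfix)
  · obtain ⟨ρ, C, V, hρ, hC, hV⟩ :=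
      h.exists_isLyapunov ha.le (hA 0) (ae_restrict_of_ae (hA0.mono fun ω h0 => h0 0)) hθ
    exact (lintegral_mono hV.negPow_le).trans_lt (hV.lintegral_lt_top hρ hC ha.le hA hN hN1 hp
      hA0 hA1 hc hAc hmom hfix hη)

end Dichotomy

section Conditions

variable {Ω : Type*} [MeasurableSpace Ω] {d : ℕ} {P : Measure Ω}

theorem PointProcessCondition.measure_lt_one [IsProbabilityMeasure P] {N : Ω → ℕ}
    {A : ℕ → Ω → Matrix (Fin d) (Fin d) ℝ} (h : PointProcessCondition P N A)
    (hN : Measurable N) : P {ω | N ω = 1} < 1 := by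
  refine prob_le_one.lt_of_ne fun hone => h.one_lt_mean.ne' ?_
  have hN1 : ∀ᵐ ω ∂P, N ω = 1 := (prob_compl_eq_zero_iff (hN (measurableSet_singleton 1))).2 hone
  rw [lintegral_congr_ae (hN1.mono fun ω hω => by rw [hω])]
  simp

theorem FurstenbergKesten.exists_ae_pos_and_rowComparable {M : Ω → Matrix (Fin d) (Fin d) ℝ}
    (h : FurstenbergKesten P M) :
    ∃ c : ℝ, (∀ᵐ ω ∂P, ∀ i j, 0 < M ω i j) ∧ ∀ᵐ ω ∂P, RowComparable c (M ω) := by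
  obtain ⟨c, hc, hM⟩ := h
  refine ⟨c, hM.mono fun ω ⟨⟨i, j, hij⟩, hle⟩ k l => ?_, hM.mono fun ω hω i j k => hω.2 i j i k⟩
  exact pos_of_mul_pos_right (hij.trans_le (hle i j k l)) (one_pos.trans hc).le

theorem vecMoment_eq_lintegral_map {X : Ω → Fin d → ℝ} (hX : AEMeasurable X P) (a : ℝ) :
    vecMoment P X (-a) = ∫⁻ x, negPow a x ∂(P.map X) :=
  (lintegral_map' (measurable_negPow a).aemeasurable hX).symm

theorem vecMoment_neg_lt_top_of_lt [IsFiniteMeasure P] {X : Ω → Fin d → ℝ} {a b : ℝ}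
    (hb : 0 < b) (hba : b < a) (h : vecMoment P X (-a) < ∞) : vecMoment P X (-b) < ∞ := by
  have hle : ∀ r : ℝ≥0∞, r ^ (-b) ≤ 1 + r ^ (-a) := fun r => by
    rcases le_total r 1 with h1 | h1
    · exact (ENNReal.rpow_le_rpow_of_exponent_ge h1 (neg_le_neg hba.le)).trans le_add_self
    · exact (ENNReal.rpow_le_one_of_one_le_of_neg h1 (neg_neg_of_pos hb)).trans le_self_add
  refine (lintegral_mono fun ω => hle _).trans_lt ?_
  rw [lintegral_add_left measurable_const, lintegral_const, one_mul]
  exact ENNReal.add_lt_top.2 ⟨measure_lt_top _ _, h⟩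

end Conditions

end Smoothing

open Smoothing in
theorem mainTheorem4_general
    {Ω Ω' : Type*} [MeasurableSpace Ω] [MeasurableSpace Ω']
    (P : Measure Ω) [IsProbabilityMeasure P] (P' : Measure Ω') [IsProbabilityMeasure P'] (d : ℕ)
    (N : Ω → ℕ) (hN : Measurable N) (hN1 : ∀ᵐ ω ∂P, 1 ≤ N ω) (hp : P {ω | N ω = 1} < 1)
    (A : ℕ → Ω → Matrix (Fin d) (Fin d) ℝ) (hA : ∀ i j k, Measurable fun ω => A i ω j k)
    (hA0 : ∀ᵐ ω ∂P, ∀ i j k, 0 ≤ A i ω j k) (hA1 : ∀ᵐ ω ∂P, 1 < N ω → A 1 ω ≠ 0)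
    (c : ℝ) (hpos : ∀ᵐ ω ∂P, ∀ i j, 0 < A 0 ω i j) (hAc : ∀ᵐ ω ∂P, RowComparable c (A 0 ω))
    (Z : Ω' → Fin d → ℝ) (hZ : AEMeasurable Z P') (hZnonneg : ∀ᵐ ω ∂P', 0 ≤ Z ω)
    (hZ0 : ∀ᵐ ω ∂P', Z ω ≠ 0) (hfix : smoothingTransform P N A (P'.map Z) = P'.map Z)
    (a : ℝ) (ha : 0 < a) (hmom : matMoment P (A 0) (-a) < ∞) :
    (P {ω | N ω = 1} = 0 → vecMoment P' Z (-a) < ∞) ∧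
    (0 < P {ω | N ω = 1} →
      (Tendsto (kappaSeq P N A (-a)) atTop (𝓝 (kappa P N A (-a))) ∧
        0 < kappa P N A (-a) ∧ kappa P N A (-a) < ∞) ∧
      (vecMoment P' Z (-a) < ∞ ↔ kappa P N A (-a) * P {ω | N ω = 1} < 1)) := by
  have : IsProbabilityMeasure (P'.map Z) := Measure.isProbabilityMeasure_map hZ
  have : NeZero d := by
    obtain ⟨ω, hω⟩ := hZ0.exists
    exact ⟨fun hd => hω (by subst hd; exact Subsingleton.elim _ _)⟩
  obtain ⟨ω, hposω, hcω⟩ := (hpos.and hAc).exists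
  have hc : 1 ≤ c := hcω.one_le hposω
  have hη : ∀ᵐ x ∂(P'.map Z), ∀ i, 0 < x i := ae_pos_of_fixedPoint hN hA hN1 hA0 hpos hfix
    ((ae_map_iff hZ measurableSet_Ici).2 hZnonneg)
    ((ae_map_iff hZ (measurableSet_singleton 0).compl).2 hZ0)
  have hiff : ∀ {θ}, HasGrowthRate (P.restrict {ω | N ω = 1}) (A 0) a θ →
      (vecMoment P' Z (-a) < ∞ ↔ θ < 1) := fun h => by
    rw [vecMoment_eq_lintegral_map hZ]
    exact h.lintegral_negPow_lt_top_iff ha hA hN hN1 hp hA0 hA1 (one_pos.trans_le hc) hAc hmom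
      hfix hη
  refine ⟨fun h0 => (hiff ?_).2 one_pos, fun h0 => ?_⟩
  · rw [Measure.restrict_eq_zero.2 h0]
    exact hasGrowthRate_zero_measure
  · obtain ⟨κ, hκ0, hκ, hgrowth, hlim⟩ := exists_hasGrowthRate_restrict ha hc (hA 0)
      (hA0.mono fun ω h => h 0) hAc hmom h0
    have hkappa : kappa P N A (-a) = κ := Tendsto.limUnder_eq hlim
    rw [hkappa]
    exact ⟨⟨hlim, pos_iff_ne_zero.2 hκ0, hκ.lt_top⟩, hiff hgrowth⟩

theorem mainTheorem4
    {Ω Ω' : Type*} [MeasurableSpace Ω] [MeasurableSpace Ω']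
    (P : Measure Ω) [IsProbabilityMeasure P]
    (P' : Measure Ω') [IsProbabilityMeasure P']
    (d : ℕ) (hd : 1 ≤ d)
    (N : Ω → ℕ) (hN : Measurable N)
    (A : ℕ → Ω → Matrix (Fin d) (Fin d) ℝ)
    (hA : ∀ i j k, Measurable fun ω => A i ω j k)
    (hcond : Smoothing.PointProcessCondition P N A)
    (hFK : Smoothing.FurstenbergKesten P (A 0))
    -- `Z` is an `ℝ₊ᵈ`-valued random variable whose law is a fixed point, and `P[Z = 0] = 0`
    (Z : Ω' → Fin d → ℝ) (hZ : AEMeasurable Z P')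
    (hZnonneg : ∀ᵐ ω ∂P', ∀ i, 0 ≤ Z ω i)
    (hfix : Smoothing.smoothingTransform P N A (P'.map Z) = P'.map Z)
    (hZ0 : P' {ω | Z ω = 0} = 0)
    (a : ℝ) (ha : 0 < a)
    (hmom : Smoothing.matMoment P (A 0) (-a) < ∞) :
    -- the case `P[N = 1] = 0`
    (P {ω | N ω = 1} = 0 →
      ∀ b : ℝ, 0 < b → b < a → Smoothing.vecMoment P' Z (-b) < ∞) ∧
    -- the case `P[N = 1] > 0`
    (0 < P {ω | N ω = 1} →
      -- the limit defining `κ̃(-a)` exists in `(0, ∞)`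
      (Tendsto (Smoothing.kappaSeq P N A (-a)) atTop (𝓝 (Smoothing.kappa P N A (-a))) ∧
        0 < Smoothing.kappa P N A (-a) ∧ Smoothing.kappa P N A (-a) < ∞) ∧
      (Smoothing.vecMoment P' Z (-a) < ∞ →
        Smoothing.kappa P N A (-a) * P {ω | N ω = 1} < 1) ∧
      (Smoothing.kappa P N A (-a) * P {ω | N ω = 1} < 1 →
        ∀ b : ℝ, 0 < b → b < a → Smoothing.vecMoment P' Z (-b) < ∞) ∧
      ((∃ ε : ℝ, 0 < ε ∧ Smoothing.matMoment P (A 0) (-a - ε) < ∞) →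
        (Smoothing.vecMoment P' Z (-a) < ∞ ↔
          Smoothing.kappa P N A (-a) * P {ω | N ω = 1} < 1))) := by
  obtain ⟨c, hpos, hAc⟩ := hFK.exists_ae_pos_and_rowComparable
  obtain ⟨hzero, hone⟩ := mainTheorem4_general P P' d N hN hcond.one_le (hcond.measure_lt_one hN)
    A hA hcond.nonneg (hcond.ne_zero.mono fun ω h => h 1) c hpos hAc Z hZ hZnonneg
    (ae_iff.2 (by simpa)) hfix a ha hmom
  refine ⟨fun h0 b hb hba => Smoothing.vecMoment_neg_lt_top_of_lt hb hba (hzero h0), fun h0 => ?_⟩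
  obtain ⟨hlim, hiff⟩ := hone h0
  exact ⟨hlim, hiff.1, fun hlt b hb hba =>
    Smoothing.vecMoment_neg_lt_top_of_lt hb hba (hiff.2 hlt), fun _ => hiff⟩
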